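/- **Setting.** For $g:\mathbb R\to\mathbb R$ write $g_{jk}(x)=2^{j/2}g(2^jx-k)$, $j,k\in\mathbb Z$. Let $\varphi,\psi:\mathbb R\to\mathbb R$ be compactly supported, where $\varphi$ is a father wavelet (its integer translates are orthonormal, the closed spans $V_j$ in $L^2(\mathbb R)$ of $\{\varphi_{jk}:k\in\mathbb Z\}$ are nested, $V_j\subseteq V_{j+1}$, and their union is dense in $L^2(\mathbb R)$) and $\psi$ is an associated mother wavelet (its integer translates form an orthonormal basis of the orthogonal complement of $V_0$ in $V_1$). Let $N\ge 0$ be an integer such that $\varphi$ is $N+1$ times weakly differentiable with $\operatorname{ess\,sup}_x\sum_k|\varphi^{(N+1)}(x-k)|<\infty$, and such that $|\varphi(u)|\le\Phi(|u|)$ for all $u$, for some bounded non-increasing $\Phi$ on $[0,\infty)$ with $\int\Phi(|u|)\,du<\infty$ and $\int\Phi(|u|)|u|^N\,du<\infty$. For $0<s<N+1$, $1\le p,q\le\infty$ put $\alpha_{0k}=\int f\varphi_{0k}$, $\beta_{jk}=\int f\psi_{jk}$, $$J_{spq}(f)=\|\alpha_{0\cdot}\|_{\ell^p}+\Big\|\big(2^{j(s+1/2-1/p)}\|\beta_{j\cdot}\|_{\ell^p}\big)_{j\ge0}\Big\|_{\ell^q}\in[0,\infty],$$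 and for $L,T>0$ let $\mathcal D=\mathcal D^s_{pq}(L,T)$ be the set of probability densities $f$ on $\mathbb R$ with support contained in $[-T,T]$ and $J_{spq}(f)\le L$. Let $\mathcal Q_\alpha$ be the set of local $\alpha$-differentially private mechanisms: sequences of Markov kernels $Q_i$ from $\mathcal Z^{i-1}\times\mathbb R$ to an arbitrary measurable space $\mathcal Z$ such that $Q_i(A\mid x,z_1,\dots,z_{i-1})\le e^{\alpha}Q_i(A\mid x',z_1,\dots,z_{i-1})$ for all $i$, all $x,x'\in\mathbb R$, all $z_1,\dots,z_{i-1}\in\mathcal Z$ and all measurable $A$. Given i.i.d. $X_1,\dots,X_n$ with density $f$, the private views are drawn successively as $Z_i\sim Q_i(\cdot\mid X_i,Z_1,\dots,Z_{i-1})$. Expectation under this model is written $\mathbb E_{f,Q}$. **Proposition.** Let $r\ge1$, $1\le p,q\le\infty$, $s>0$, $1/p\le s<N+1$, $L,T>0$, and suppose that $L$ is not degenerate, that is, some probability density $f$ supported in $[-T,T]$ satisfies $J_{spq}(f)<L$. Then there are constants $C>0$ and $m_0$, depending only on $\varphi,\psi,N,s,p,q,r,L,T$, such that for all $\alpha>0$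 and all integers $n\ge 0$ with $n(e^\alpha-1)^2\ge m_0$, $$\inf_{\widetilde f,\;Q\in\mathcal Q_\alpha}\ \sup_{f\in\mathcal D^s_{pq}(L,T)}\mathbb E_{f,Q}\|\widetilde f-f\|_r^r\ \ge\ C\left(\frac{\log\big(n(e^\alpha-1)^2\big)}{n(e^\alpha-1)^2}\right)^{r\,\frac{s-1/p+1/r}{2(s-1/p)+2}},$$ where the infimum is over all mechanisms $Q\in\mathcal Q_\alpha$ and all estimators $\widetilde f$ based on the private views $Z_1,\dots,Z_n$ (jointly measurable functions of $(Z_1,\dots,Z_n)$ and $x$). In particular, for every fixed $\alpha\in(0,\infty)$ the bound holds for all sufficiently large $n$. -/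

import Mathlib

open MeasureTheory ProbabilityTheory
open scoped ENNReal

universe u

noncomputable section

namespace LDPBesov

/-! ### Wavelets -/

/-- The dilated and translated function `g_{jk}(x) = 2^{j/2} g(2^j x - k)`. -/
def dyadic (g : ℝ → ℝ) (j k : ℤ) (x : ℝ) : ℝ :=
  (2 : ℝ) ^ ((j : ℝ) / 2) * g ((2 : ℝ) ^ j * x - (k : ℝ))

/-- The closed linear span in `L²(ℝ)` of the functions `g_{jk}`, `k ∈ ℤ`, at resolution level `j`. -/
def levelSpace (g : ℝ → ℝ) (j : ℤ) : Submodule ℝ (Lp ℝ 2 (volume : Measure ℝ)) :=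
  (Submodule.span ℝ {u : Lp ℝ 2 (volume : Measure ℝ) |
    ∃ k : ℤ, ⇑u =ᵐ[volume] dyadic g j k}).topologicalClosure

/-- `g` is square integrable and its integer translates form an orthonormal system of `L²(ℝ)`. -/
def OrthonormalTranslates (g : ℝ → ℝ) : Prop :=
  MemLp g 2 volume ∧
    ∀ k l : ℤ, ∫ x, dyadic g 0 k x * dyadic g 0 l x = if k = l then 1 else 0

/-- `φ` is a father wavelet: it generates a multiresolution analysis of `L²(ℝ)`. -/
structure GeneratesMRA (φ : ℝ → ℝ) : Prop where
  orthonormal : OrthonormalTranslates φ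
  nested : ∀ j : ℤ, levelSpace φ j ≤ levelSpace φ (j + 1)
  dense : (⨆ j : ℤ, levelSpace φ j).topologicalClosure = ⊤

/-- `ψ` is a mother wavelet associated with the father wavelet `φ`: its integer translates form
an orthonormal basis of the orthogonal complement of `V₀` in `V₁`. -/
structure IsMotherWavelet (φ ψ : ℝ → ℝ) : Prop where
  orthonormal : OrthonormalTranslates ψ
  span_eq : levelSpace ψ 0 = (levelSpace φ 0)ᗮ ⊓ levelSpace φ 1

/-- The locally integrable function `g` is the weak derivative of order `m` of `f`. -/
def IsWeakDeriv (m : ℕ) (f g : ℝ → ℝ) : Prop :=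
  LocallyIntegrable f volume ∧ LocallyIntegrable g volume ∧
    ∀ θ : ℝ → ℝ, ContDiff ℝ (⊤ : ℕ∞) θ → HasCompactSupport θ →
      ∫ x, f x * iteratedDeriv m θ x = (-1) ^ m * ∫ x, g x * θ x

/-- Regularity of order `N + 1` and decay of the father wavelet. -/
structure FatherRegular (N : ℕ) (φ : ℝ → ℝ) : Prop where
  weakDeriv : ∃ g : ℝ → ℝ, IsWeakDeriv (N + 1) φ g ∧
    ∃ B : ℝ, ∀ᵐ x ∂(volume : Measure ℝ), ∑' k : ℤ, ‖g (x - (k : ℝ))‖ₑ ≤ ENNReal.ofReal B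
  decay : ∃ Φ : ℝ → ℝ, AntitoneOn Φ (Set.Ici 0) ∧ (∃ B : ℝ, ∀ u, 0 ≤ u → |Φ u| ≤ B) ∧
    (∀ u, |φ u| ≤ Φ |u|) ∧
    Integrable (fun u => Φ |u|) volume ∧ Integrable (fun u => Φ |u| * |u| ^ N) volume

/-- `φ` and `ψ` generate a compactly supported orthonormal wavelet basis of `L²(ℝ)` whose father
wavelet is regular of order `N + 1`. -/
structure IsWaveletPair (N : ℕ) (φ ψ : ℝ → ℝ) : Prop where
  mra : GeneratesMRA φ
  regular : FatherRegular N φ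
  mother : IsMotherWavelet φ ψ
  compact : ∃ A : ℝ, ∀ x, A < |x| → φ x = 0 ∧ ψ x = 0

/-! ### Besov ellipsoids of densities -/

/-- The coefficient `∫ f g_{jk}` of `f`. -/
def waveletCoeff (g f : ℝ → ℝ) (j k : ℤ) : ℝ := ∫ x, f x * dyadic g j k x

/-- The norm `J_{spq}(f) = ‖α_{0·}‖_p + ‖(2^{j(s + 1/2 - 1/p)} ‖β_{j·}‖_p)_{j ≥ 0}‖_q`, where
`‖·‖_p` and `‖·‖_q` are the norms of `ℓ^p(ℤ)` and `ℓ^q(ℕ)`; it may be infinite. -/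
def besovJ (φ ψ : ℝ → ℝ) (s : ℝ) (p q : ℝ≥0∞) (f : ℝ → ℝ) : ℝ≥0∞ :=
  eLpNorm (fun k : ℤ => waveletCoeff φ f 0 k) p Measure.count +
    eLpNorm (fun j : ℕ => (2 : ℝ≥0∞) ^ ((j : ℝ) * (s + 1 / 2 - (1 / p).toReal)) *
      eLpNorm (fun k : ℤ => waveletCoeff ψ f (j : ℤ) k) p Measure.count) q Measure.count

/-- The probability densities supported in `[-T, T]` that lie in the Besov ellipsoid of
radius `L`. -/
def densityClass (φ ψ : ℝ → ℝ) (s : ℝ) (p q : ℝ≥0∞) (L T : ℝ) : Set (ℝ → ℝ) :=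
  {f | (∀ x, 0 ≤ f x) ∧ Integrable f volume ∧ ∫ x, f x = 1 ∧
    Function.support f ⊆ Set.Icc (-T) T ∧ besovJ φ ψ s p q f ≤ ENNReal.ofReal L}

/-! ### Local differential privacy -/

/-- A (sequentially interactive) local `α`-differentially private mechanism with values in `Z`.
With indices starting at `0`, the kernel `Q i` is the conditional law of the `i`-th release given
the previous releases `z` and the `i`-th private observation `x`. Only the first `n` kernels
matter for `n` data holders. Non-interactive mechanisms are those with `Q i (z, x)` independent
of `i` and `z`. -/
structure PrivateMechanism (α : ℝ) (Z : Type*) [MeasurableSpace Z] where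
  Q : (i : ℕ) → Kernel ((Fin i → Z) × ℝ) Z
  markov : ∀ i, IsMarkovKernel (Q i)
  isPrivate : ∀ (i : ℕ) (z : Fin i → Z) (x x' : ℝ) (A : Set Z), MeasurableSet A →
    Q i (z, x) A ≤ ENNReal.ofReal (Real.exp α) * Q i (z, x') A

/-- The conditional law `Q^n(· | x_1, …, x_n)` of the private sample `(Z_1, …, Z_n)`, obtained by
successively applying the kernels of the mechanism. -/
def release {Z : Type*} [MeasurableSpace Z] (Q : (i : ℕ) → Kernel ((Fin i → Z) × ℝ) Z) :
    (n : ℕ) → Kernel (Fin n → ℝ) (Fin n → Z)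
  | 0 => Kernel.const _ (Measure.dirac Fin.elim0)
  | n + 1 =>
      (((release Q n).comap (fun (x : Fin (n + 1) → ℝ) (i : Fin n) => x i.castSucc)
          (by fun_prop)) ⊗ₖ
        ((Q n).comap (fun w : (Fin (n + 1) → ℝ) × (Fin n → Z) => (w.2, w.1 (Fin.last n)))
          (by fun_prop))).map
        (fun w : (Fin n → Z) × Z => (Fin.snoc w.1 w.2 : Fin (n + 1) → Z))

/-- The law of the private sample `(Z_1, …, Z_n)` when `X_1, …, X_n` are i.i.d. with
density `f`. -/
def privateLaw {Z : Type*} [MeasurableSpace Z] (Q : (i : ℕ) → Kernel ((Fin i → Z) × ℝ) Z)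
    (n : ℕ) (f : ℝ → ℝ) : Measure (Fin n → Z) :=
  (Measure.pi fun _ : Fin n => (volume : Measure ℝ).withDensity fun x => ENNReal.ofReal (f x)).bind
    (release Q n)

/-- Estimators of a density based on a private sample `(Z_1, …, Z_n)`. -/
def Estimator (n : ℕ) (Z : Type*) [MeasurableSpace Z] : Type _ :=
  {g : (Fin n → Z) → ℝ → ℝ // Measurable (Function.uncurry g)}

/-- The risk `E_{f,Q} ‖g - f‖_r^r`. -/
def risk {Z : Type*} [MeasurableSpace Z] (r : ℝ) (n : ℕ)
    (Q : (i : ℕ) → Kernel ((Fin i → Z) × ℝ) Z) (g : Estimator n Z) (f : ℝ → ℝ) : ℝ≥0∞ :=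
  ∫⁻ z, ∫⁻ x, ENNReal.ofReal (|g.1 z x - f x| ^ r) ∂volume ∂(privateLaw Q n f)

/-- The local `α`-private minimax `L^r`-risk over a class `F` of densities: the infimum is over
all measurable spaces `Z` of releases, all `α`-private mechanisms with values in `Z`, and all
estimators based on the private sample. -/
def privateMinimaxRisk (r : ℝ) (n : ℕ) (α : ℝ) (F : Set (ℝ → ℝ)) : ℝ≥0∞ :=
  ⨅ (Z : Type u) (_ : MeasurableSpace Z) (M : PrivateMechanism α Z) (g : Estimator n Z),
    ⨆ f ∈ F, risk r n M.Q g f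

end LDPBesov

end

/-!
Fix a density `f₀` in the interior of the Besov ellipsoid, bounded below on `[-T/2, T/2]`, and
perturb it by single wavelets, `f₀ + γ ψ_{jk}`, at about `2 ^ (j/2)` positions `k` for which the
supports are disjoint and lie in `[-T/2, T/2]`. Such an `f₀` is a mixture of a given density with
`J(f) < L` and a smooth bump, whose Besov norm is finite because `ψ` has `N + 1` vanishing moments:
if the first nonvanishing one had order `m ≤ N`, then `∫ φ ψ_{jk} = 0` at all levels `j ≥ 0` would
force `φ^(m) = 0`, hence `φ = 0`.

Under `α`-privacy the likelihood ratio of one private view deviates from `1` by at most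
`t = (e ^ α - 1) ‖f - f₀‖₁`, so the ratio of `n` of them has second moment at most
`(1 + t ^ 2) ^ n`. The events that an estimator is close to the various perturbations are disjoint,
so one of them has small probability under `f₀`, and by Cauchy–Schwarz probability at most `1/2`
under its own perturbation, as long as `(1 + t ^ 2) ^ n` is small against the number of
perturbations. With `σ = s - 1/p`, the largest amplitude that the Besov norm allows is
`γ ≍ 2 ^ (-j (σ + 1/2))`, and then this holds for `2 ^ (j (2 σ + 2)) ≍ m / log m`, where
`m = n (e ^ α - 1) ^ 2`.
-/

namespace LDPBesov

/-! ### Dilations and translations -/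

section Dilation

variable {f g : ℝ → ℝ} {p : ℝ≥0∞}

lemma map_volume_affine (j k : ℤ) :
    Measure.map (fun x : ℝ => (2 : ℝ) ^ j * x - k) volume =
      ENNReal.ofReal ((2 : ℝ) ^ j)⁻¹ • volume := by
  have hcomp : (fun x : ℝ => (2 : ℝ) ^ j * x - k) = (fun y => y - (k : ℝ)) ∘ fun x => 2 ^ j * x :=
    rfl
  rw [hcomp, ← Measure.map_map (by fun_prop) (by fun_prop),
    Real.map_volume_mul_left (by positivity), Measure.map_smul,
    (measurePreserving_sub_right volume (k : ℝ)).map_eq, abs_of_pos (by positivity)]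

lemma quasiMeasurePreserving_affine (j k : ℤ) :
    Measure.QuasiMeasurePreserving (fun x : ℝ => (2 : ℝ) ^ j * x - k) volume volume :=
  ⟨by fun_prop, by rw [map_volume_affine]; exact Measure.smul_absolutelyContinuous⟩

lemma integral_comp_affine (F : ℝ → ℝ) (j k : ℤ) :
    ∫ x, F ((2 : ℝ) ^ j * x - k) = ((2 : ℝ) ^ j)⁻¹ * ∫ x, F x := by
  rw [Measure.integral_comp_mul_left (fun y => F (y - k)), integral_sub_right_eq_self, smul_eq_mul,
    abs_of_pos (by positivity)]

lemma two_rpow_half_sq (j : ℤ) : ((2 : ℝ) ^ ((j : ℝ) / 2)) ^ 2 = (2 : ℝ) ^ j := by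
  rw [← Real.rpow_natCast, ← Real.rpow_mul zero_le_two]
  simp

lemma dyadic_zero (g : ℝ → ℝ) (k : ℤ) (x : ℝ) : dyadic g 0 k x = g (x - k) := by
  simp [dyadic]

lemma dyadic_ae_congr (h : f =ᵐ[volume] g) (j k : ℤ) : dyadic f j k =ᵐ[volume] dyadic g j k := by
  filter_upwards [(quasiMeasurePreserving_affine j k).ae h] with x hx
  simp only [dyadic, hx]

lemma memLp_dyadic (hg : MemLp g p) (j k : ℤ) : MemLp (dyadic g j k) p := by
  refine MemLp.const_mul (MemLp.comp_of_map ?_ (by fun_prop)) _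
  rw [map_volume_affine]
  exact hg.smul_measure ENNReal.ofReal_ne_top

lemma abs_dyadic_le {B : ℝ} (hB : ∀ x, |g x| ≤ B) (j k : ℤ) (x : ℝ) :
    |dyadic g j k x| ≤ 2 ^ ((j : ℝ) / 2) * B := by
  rw [dyadic, abs_mul, abs_of_pos (by positivity)]
  gcongr
  exact hB _

lemma integral_mul_dyadic (F g : ℝ → ℝ) (j k : ℤ) :
    ∫ x, F x * dyadic g j k x =
      2 ^ (-(j : ℝ) / 2) * ∫ y, F (2 ^ (-j) * k + 2 ^ (-j) * y) * g y := by
  have hpoint : ∀ x, F x * dyadic g j k x = 2 ^ ((j : ℝ) / 2) *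
      (fun y => F (2 ^ (-j) * k + 2 ^ (-j) * y) * g y) ((2 : ℝ) ^ j * x - k) := by
    intro x
    have harg : (2 : ℝ) ^ (-j) * k + 2 ^ (-j) * (2 ^ j * x - k) = x := by
      rw [zpow_neg]
      field_simp
      ring
    simp only [dyadic, harg]
    ring
  simp_rw [hpoint]
  rw [integral_const_mul, integral_comp_affine fun y => F (2 ^ (-j) * k + 2 ^ (-j) * y) * g y,
    ← mul_assoc, ← two_rpow_half_sq, neg_div, Real.rpow_neg zero_le_two, sq, mul_inv,
    mul_inv_cancel_left₀ (by positivity)]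

lemma integral_abs_dyadic_rpow (g : ℝ → ℝ) (j k : ℤ) (r : ℝ) :
    ∫ x, |dyadic g j k x| ^ r = 2 ^ ((j : ℝ) * (r / 2 - 1)) * ∫ x, |g x| ^ r := by
  have hpoint : ∀ x, |dyadic g j k x| ^ r =
      ((2 : ℝ) ^ ((j : ℝ) / 2)) ^ r * (fun y => |g y| ^ r) ((2 : ℝ) ^ j * x - k) := by
    intro x
    rw [dyadic, abs_mul, abs_of_pos (by positivity),
      Real.mul_rpow (by positivity) (by positivity)]
  simp_rw [hpoint]
  rw [integral_const_mul, integral_comp_affine fun y => |g y| ^ r, ← mul_assoc,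
    ← Real.rpow_intCast, ← Real.rpow_neg zero_le_two, ← Real.rpow_mul zero_le_two,
    ← Real.rpow_add two_pos]
  ring_nf

lemma dyadic_add (g : ℝ → ℝ) (i j k : ℤ) (x : ℝ) :
    dyadic g (i + j) k x = (2 : ℝ) ^ ((j : ℝ) / 2) * dyadic g i k ((2 : ℝ) ^ j * x) := by
  simp only [dyadic]
  rw [zpow_add₀ two_ne_zero, ← mul_assoc, ← mul_assoc, ← Real.rpow_add two_pos]
  push_cast
  ring_nf

lemma integral_dyadic_add_mul_dyadic_add (f g : ℝ → ℝ) (i i' j k l : ℤ) :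
    ∫ x, dyadic f (i + j) k x * dyadic g (i' + j) l x =
      ∫ x, dyadic f i k x * dyadic g i' l x := by
  have hpoint : ∀ x, dyadic f (i + j) k x * dyadic g (i' + j) l x = (2 : ℝ) ^ j *
      (fun y => dyadic f i k y * dyadic g i' l y) ((2 : ℝ) ^ j * x - (0 : ℤ)) := by
    intro x
    rw [dyadic_add, dyadic_add, ← two_rpow_half_sq j, Int.cast_zero, sub_zero]
    ring
  simp_rw [hpoint]
  rw [integral_const_mul, integral_comp_affine fun y => dyadic f i k y * dyadic g i' l y,
    mul_inv_cancel_left₀ (by positivity)]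

lemma integral_dyadic_mul_dyadic (f g : ℝ → ℝ) (j k l : ℤ) :
    ∫ x, dyadic f j k x * dyadic g j l x = ∫ x, dyadic f 0 k x * dyadic g 0 l x := by
  simpa only [zero_add] using integral_dyadic_add_mul_dyadic_add f g 0 0 j k l

end Dilation

section Coefficients

variable {f g g' : ℝ → ℝ} {A T : ℝ}

lemma waveletCoeff_congr (h : g =ᵐ[volume] g') (f : ℝ → ℝ) (j k : ℤ) :
    waveletCoeff g f j k = waveletCoeff g' f j k := by
  refine integral_congr_ae ?_
  filter_upwards [dyadic_ae_congr h j k] with x hx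
  rw [hx]

/-- The indices `k` of the translates `g_{jk}` that can meet `[-T, T]` when `g` vanishes off
`[-A, A]`. -/
noncomputable def translatesMeeting (A T : ℝ) (j : ℤ) : Finset ℤ :=
  Finset.Icc (-(⌈(2 : ℝ) ^ j * T + A⌉₊ : ℤ)) ⌈(2 : ℝ) ^ j * T + A⌉₊

lemma waveletCoeff_eq_zero (hg : ∀ x, A < |x| → g x = 0) (hf : ∀ x, T < |x| → f x = 0) {j k : ℤ}
    (hk : k ∉ translatesMeeting A T j) : waveletCoeff g f j k = 0 := by
  have hk' : (2 : ℝ) ^ j * T + A < |(k : ℝ)| := by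
    rw [translatesMeeting, Finset.mem_Icc, ← abs_le, not_le] at hk
    exact (Nat.le_ceil _).trans_lt (by exact_mod_cast hk)
  refine integral_eq_zero_of_ae (.of_forall fun x => ?_)
  rcases lt_or_ge T |x| with hx | hx
  · simp [hf x hx]
  · have hdist := abs_sub_abs_le_abs_sub (k : ℝ) ((2 : ℝ) ^ j * x)
    rw [abs_sub_comm, abs_mul, abs_of_pos (by positivity : (0 : ℝ) < 2 ^ j)] at hdist
    have hscale : (2 : ℝ) ^ j * |x| ≤ 2 ^ j * T := by gcongr
    simp [dyadic, hg ((2 : ℝ) ^ j * x - k) (by linarith)]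

end Coefficients

/-! ### Orthogonality relations -/

section Hilbert

variable {ι E : Type*} [NormedAddCommGroup E] [InnerProductSpace ℝ E] {v : ι → E} {u w : E}

lemma inner_eq_zero_of_mem_closure_span (hw : ∀ i, inner ℝ (v i) w = 0)
    (hu : u ∈ (Submodule.span ℝ (Set.range v)).topologicalClosure) : inner ℝ u w = 0 := by
  have hle : Submodule.span ℝ (Set.range v) ≤ (Submodule.span ℝ {w})ᗮ := by
    rw [Submodule.span_le]
    rintro _ ⟨i, rfl⟩
    exact Submodule.mem_orthogonal_singleton_iff_inner_left.2 (hw i)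
  exact Submodule.mem_orthogonal_singleton_iff_inner_left.1
    (Submodule.topologicalClosure_minimal _ hle (Submodule.isClosed_orthogonal _) hu)

lemma eq_sum_of_mem_closure_span (hv : Orthonormal ℝ v)
    (hu : u ∈ (Submodule.span ℝ (Set.range v)).topologicalClosure) {S : Finset ι}
    (hS : ∀ i ∉ S, inner ℝ (v i) u = 0) : u = ∑ i ∈ S, inner ℝ (v i) u • v i := by
  have hproj : ∑ i ∈ S, inner ℝ (v i) u • v i ∈
      (Submodule.span ℝ (Set.range v)).topologicalClosure :=
    Submodule.sum_mem _ fun i _ => Submodule.smul_mem _ _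
      (Submodule.le_topologicalClosure _ (Submodule.subset_span ⟨i, rfl⟩))
  have horth : ∀ i, inner ℝ (v i) (u - ∑ i ∈ S, inner ℝ (v i) u • v i) = 0 := by
    intro i
    rw [inner_sub_right, sub_eq_zero]
    by_cases hi : i ∈ S
    · rw [hv.inner_right_sum _ hi]
    · rw [hS i hi, inner_sum]
      refine (Finset.sum_eq_zero fun k hk => ?_).symm
      rw [inner_smul_right, hv.inner_eq_zero (ne_of_mem_of_not_mem hk hi).symm, mul_zero]
  exact sub_eq_zero.1 (inner_self_eq_zero.1
    (inner_eq_zero_of_mem_closure_span horth (Submodule.sub_mem _ hu hproj)))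

end Hilbert

section Orthogonality

variable {f g φ ψ : ℝ → ℝ}

/-- The function `g_{jk}` as an element of `L²(ℝ)`. -/
noncomputable def dyadicLp (hg : MemLp g 2) (j k : ℤ) : Lp ℝ 2 (volume : Measure ℝ) :=
  (memLp_dyadic hg j k).toLp

lemma inner_toLp (hf : MemLp f 2) (hg : MemLp g 2) :
    inner ℝ hf.toLp hg.toLp = ∫ x, f x * g x := by
  rw [L2.inner_def]
  refine integral_congr_ae ?_
  filter_upwards [hf.coeFn_toLp, hg.coeFn_toLp] with x hfx hgx
  simp [hfx, hgx, mul_comm]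

lemma inner_dyadicLp (hf : MemLp f 2) (hg : MemLp g 2) (i j k l : ℤ) :
    inner ℝ (dyadicLp hf i k) (dyadicLp hg j l) = ∫ x, dyadic f i k x * dyadic g j l x :=
  inner_toLp _ _

lemma inner_dyadicLp_toLp (hg : MemLp g 2) (hf : MemLp f 2) (j k : ℤ) :
    inner ℝ (dyadicLp hg j k) hf.toLp = waveletCoeff g f j k := by
  simp_rw [dyadicLp, inner_toLp, waveletCoeff, mul_comm]

lemma OrthonormalTranslates.orthonormal_dyadicLp (hg : OrthonormalTranslates g) (j : ℤ) :
    Orthonormal ℝ (dyadicLp hg.1 j) := by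
  rw [orthonormal_iff_ite]
  intro k l
  rw [inner_dyadicLp, integral_dyadic_mul_dyadic, hg.2]

lemma levelSpace_eq_closure_span (hg : MemLp g 2) (j : ℤ) :
    levelSpace g j = (Submodule.span ℝ (Set.range (dyadicLp hg j))).topologicalClosure := by
  have hset : {u : Lp ℝ 2 (volume : Measure ℝ) | ∃ k : ℤ, ⇑u =ᵐ[volume] dyadic g j k} =
      Set.range (dyadicLp hg j) := by
    ext u
    exact exists_congr fun k =>
      ⟨fun hu => Lp.ext ((MemLp.coeFn_toLp (memLp_dyadic hg j k)).trans hu.symm),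
        fun hu => hu ▸ MemLp.coeFn_toLp _⟩
  rw [levelSpace, hset]

lemma dyadicLp_mem_levelSpace (hg : MemLp g 2) (j k : ℤ) : dyadicLp hg j k ∈ levelSpace g j := by
  rw [levelSpace_eq_closure_span hg]
  exact Submodule.le_topologicalClosure _ (Submodule.subset_span ⟨k, rfl⟩)

lemma ae_eq_sum_dyadic (hφ : OrthonormalTranslates φ) (hg : MemLp g 2 volume) {j : ℤ}
    (hmem : hg.toLp ∈ levelSpace φ j) {S : Finset ℤ} (hS : ∀ k ∉ S, waveletCoeff φ g j k = 0) :
    g =ᵐ[volume] fun x => ∑ k ∈ S, waveletCoeff φ g j k * dyadic φ j k x := by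
  rw [levelSpace_eq_closure_span hφ.1] at hmem
  have hsum : hg.toLp = ∑ k ∈ S, waveletCoeff φ g j k • dyadicLp hφ.1 j k := by
    simpa only [inner_dyadicLp_toLp] using eq_sum_of_mem_closure_span (hφ.orthonormal_dyadicLp j)
      hmem (S := S) (fun k hk => by rw [inner_dyadicLp_toLp, hS k hk])
  have hterm : ∀ᵐ x, ∀ k, (waveletCoeff φ g j k • dyadicLp hφ.1 j k) x =
      waveletCoeff φ g j k * dyadic φ j k x := by
    refine ae_all_iff.2 fun k => ?_
    filter_upwards [Lp.coeFn_smul (waveletCoeff φ g j k) (dyadicLp hφ.1 j k),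
      (memLp_dyadic hφ.1 j k).coeFn_toLp] with x hsmul hdyadic
    rw [hsmul, Pi.smul_apply, smul_eq_mul, dyadicLp, hdyadic]
  have hcoe := hg.coeFn_toLp
  rw [hsum] at hcoe
  filter_upwards [hcoe, Lp.coeFn_finsetSum S fun k => waveletCoeff φ g j k • dyadicLp hφ.1 j k,
    hterm] with x hx hfinset hxterm
  rw [← hx, hfinset, Finset.sum_apply]
  exact Finset.sum_congr rfl fun k _ => hxterm k

lemma IsMotherWavelet.dyadicLp_mem (hψ : IsMotherWavelet φ ψ) (k : ℤ) :
    dyadicLp hψ.orthonormal.1 0 k ∈ (levelSpace φ 0)ᗮ ⊓ levelSpace φ 1 :=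
  hψ.span_eq ▸ dyadicLp_mem_levelSpace hψ.orthonormal.1 0 k

lemma integral_father_mul_mother_same_level (hφ : MemLp φ 2) (hψ : IsMotherWavelet φ ψ)
    (j k l : ℤ) : ∫ x, dyadic φ j k x * dyadic ψ j l x = 0 := by
  rw [integral_dyadic_mul_dyadic, ← inner_dyadicLp hφ hψ.orthonormal.1]
  exact (Submodule.mem_orthogonal _ _).1 (hψ.dyadicLp_mem l).1 _ (dyadicLp_mem_levelSpace hφ 0 k)

lemma inner_dyadicLp_mother_eq_zero (hφ : GeneratesMRA φ) (hψ : IsMotherWavelet φ ψ) {i j : ℤ}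
    (hij : i ≤ j) {u : Lp ℝ 2 (volume : Measure ℝ)} (hu : u ∈ levelSpace φ i) (l : ℤ) :
    inner ℝ u (dyadicLp hψ.orthonormal.1 j l) = 0 := by
  have huj := monotone_int_of_le_succ hφ.nested hij hu
  rw [levelSpace_eq_closure_span hφ.orthonormal.1] at huj
  refine inner_eq_zero_of_mem_closure_span (fun k => ?_) huj
  rw [inner_dyadicLp, integral_father_mul_mother_same_level hφ.orthonormal.1 hψ]

lemma integral_father_mul_mother (hφ : GeneratesMRA φ) (hψ : IsMotherWavelet φ ψ) {i j : ℤ}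
    (hij : i ≤ j) (k l : ℤ) : ∫ x, dyadic φ i k x * dyadic ψ j l x = 0 := by
  rw [← inner_dyadicLp hφ.orthonormal.1 hψ.orthonormal.1]
  exact inner_dyadicLp_mother_eq_zero hφ hψ hij (dyadicLp_mem_levelSpace _ i k) l

lemma integral_mother_mul_mother_of_lt (hφ : GeneratesMRA φ) (hψ : IsMotherWavelet φ ψ) {i j : ℤ}
    (hij : i < j) (k l : ℤ) : ∫ x, dyadic ψ i k x * dyadic ψ j l x = 0 := by
  have hshift := integral_dyadic_add_mul_dyadic_add ψ ψ 0 (j - i) i k l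
  rw [zero_add, sub_add_cancel] at hshift
  rw [hshift, ← inner_dyadicLp hψ.orthonormal.1 hψ.orthonormal.1]
  exact inner_dyadicLp_mother_eq_zero hφ hψ (by omega) (hψ.dyadicLp_mem k).2 l

lemma integral_mother_mul_mother (hφ : GeneratesMRA φ) (hψ : IsMotherWavelet φ ψ)
    (i j k l : ℤ) :
    ∫ x, dyadic ψ i k x * dyadic ψ j l x = if i = j ∧ k = l then 1 else 0 := by
  rcases lt_trichotomy i j with hij | rfl | hij
  · rw [integral_mother_mul_mother_of_lt hφ hψ hij, if_neg (by omega)]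
  · rw [integral_dyadic_mul_dyadic, hψ.orthonormal.2]
    simp only [true_and]
  · simp_rw [mul_comm (dyadic ψ i k _)]
    rw [integral_mother_mul_mother_of_lt hφ hψ hij, if_neg (by omega)]

/-- A compactly supported mother wavelet is a finite combination of the bounded `φ_{1k}`. -/
lemma IsMotherWavelet.memLp_top (hφ : OrthonormalTranslates φ) (hψ : IsMotherWavelet φ ψ) {A : ℝ}
    (hA : ∀ x, A < |x| → φ x = 0 ∧ ψ x = 0) (hφ_top : MemLp φ ∞) : MemLp ψ ∞ := by
  have hψ2 := hψ.orthonormal.1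
  have hmem : hψ2.toLp ∈ levelSpace φ 1 := by
    have hzero : dyadicLp hψ2 0 0 = hψ2.toLp :=
      MemLp.toLp_congr _ _ (.of_forall fun x => by simp [dyadic])
    exact hzero ▸ (hψ.dyadicLp_mem 0).2
  have hsum : MemLp (fun x => ∑ k ∈ translatesMeeting A A 1,
      waveletCoeff φ ψ 1 k * dyadic φ 1 k x) ∞ :=
    memLp_finsetSum _ fun k _ => (memLp_dyadic hφ_top 1 k).const_mul _
  exact hsum.ae_eq (ae_eq_sum_dyadic hφ hψ2 hmem fun k hk =>
    waveletCoeff_eq_zero (fun x hx => (hA x hx).1) (fun x hx => (hA x hx).2) hk).symm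

end Orthogonality

/-! ### Bounded representatives -/

/-- `g` is measurable, bounded by `B` everywhere, and vanishes off `[-A, A]`. -/
structure IsBddSupported (A B : ℝ) (g : ℝ → ℝ) : Prop where
  measurable : Measurable g
  abs_le : ∀ x, |g x| ≤ B
  eq_zero : ∀ x, A < |x| → g x = 0

lemma support_subset_Icc {g : ℝ → ℝ} {A : ℝ} (hg : ∀ x, A < |x| → g x = 0) :
    Function.support g ⊆ Set.Icc (-A) A := by
  intro x hx
  rw [Set.mem_Icc, ← abs_le]
  exact not_lt.1 fun hA => hx (hg x hA)

namespace IsBddSupported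

variable {A A' B B' : ℝ} {g G : ℝ → ℝ}

lemma bound_nonneg (hg : IsBddSupported A B g) : 0 ≤ B := (abs_nonneg _).trans (hg.abs_le 0)

lemma mono (hg : IsBddSupported A B g) (hA : A ≤ A') (hB : B ≤ B') : IsBddSupported A' B' g :=
  ⟨hg.measurable, fun x => (hg.abs_le x).trans hB, fun x hx => hg.eq_zero x (hA.trans_lt hx)⟩

lemma integrable (hg : IsBddSupported A B g) : Integrable g := by
  rw [← integrableOn_iff_integrable_of_support_subset (support_subset_Icc hg.eq_zero)]
  exact Measure.integrableOn_of_bounded (M := B) (by simp) hg.measurable.aestronglyMeasurable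
    (.of_forall hg.abs_le)

lemma memLp_top (hg : IsBddSupported A B g) : MemLp g ∞ :=
  memLp_top_of_bound hg.measurable.aestronglyMeasurable B (.of_forall hg.abs_le)

lemma integrable_continuous_mul (hg : IsBddSupported A B g) (hG : Continuous G) :
    Integrable fun x => G x * g x := by
  rw [← integrableOn_iff_integrable_of_support_subset (s := Set.Icc (-A) A)]
  · exact hg.integrable.integrableOn.continuousOn_mul hG.continuousOn isCompact_Icc
  · exact (Function.support_mul_subset_right _ _).trans (support_subset_Icc hg.eq_zero)

lemma integrable_abs_rpow (hg : IsBddSupported A B g) {r : ℝ} (hr : 0 < r) :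
    Integrable fun x => |g x| ^ r := by
  refine (IsBddSupported.mk (A := A) (B := B ^ r) (hg.measurable.abs.pow_const r) (fun x => ?_)
    fun x hx => ?_).integrable
  · rw [abs_of_nonneg (by positivity)]
    exact Real.rpow_le_rpow (abs_nonneg _) (hg.abs_le x) hr.le
  · rw [hg.eq_zero x hx, abs_zero, Real.zero_rpow hr.ne']

end IsBddSupported

section Representatives

variable {f f' g φ ψ : ℝ → ℝ} {m N : ℕ}

lemma exists_isBddSupported_ae_eq {A : ℝ} (hg : MemLp g ∞) (hA : ∀ x, A < |x| → g x = 0) :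
    ∃ (B : ℝ) (g' : ℝ → ℝ), IsBddSupported A B g' ∧ g =ᵐ[volume] g' := by
  set B := (eLpNorm g ∞ volume).toReal
  have hB : ∀ᵐ x, |g x| ≤ B := by
    filter_upwards [ae_le_eLpNormEssSup (f := g) (μ := volume)] with x hx
    simpa only [toReal_enorm, Real.norm_eq_abs] using ENNReal.toReal_mono hg.2.ne hx
  set h := hg.1.mk g
  have hm : Measurable h := hg.1.stronglyMeasurable_mk.measurable
  set s := {x | |x| ≤ A ∧ |h x| ≤ B}
  have hs : MeasurableSet s :=
    (measurableSet_le measurable_abs measurable_const).inter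
      (measurableSet_le hm.abs measurable_const)
  refine ⟨B, s.indicator h, ⟨hm.indicator hs, fun x => ?_, fun x hx => ?_⟩, ?_⟩
  · by_cases hx : x ∈ s
    · rw [Set.indicator_of_mem hx]
      exact hx.2
    · rw [Set.indicator_of_notMem hx, abs_zero]
      exact ENNReal.toReal_nonneg
  · exact Set.indicator_of_notMem (fun hxs => hxs.1.not_gt hx) _
  · filter_upwards [hB, hg.1.ae_eq_mk] with x hxB (hxh : g x = h x)
    by_cases hx : |x| ≤ A
    · rw [Set.indicator_of_mem (show x ∈ s from ⟨hx, hxh ▸ hxB⟩), hxh]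
    · rw [Set.indicator_of_notMem fun hxs => hx hxs.1, hA x (not_le.1 hx)]

lemma IsWeakDeriv.congr_left (h : IsWeakDeriv m f g) (hf : f =ᵐ[volume] f') :
    IsWeakDeriv m f' g := by
  refine ⟨h.1.congr hf, h.2.1, fun θ hθ hθc => ?_⟩
  rw [← h.2.2 θ hθ hθc]
  refine integral_congr_ae ?_
  filter_upwards [hf] with x hx
  rw [hx]

lemma ae_abs_le_of_tsum_translates_le {D : ℝ}
    (hD : ∀ᵐ x, ∑' k : ℤ, ‖g (x - k)‖ₑ ≤ ENNReal.ofReal D) : ∀ᵐ x, |g x| ≤ max D 0 := by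
  filter_upwards [hD] with x hx
  have hterm : ‖g x‖ₑ ≤ ENNReal.ofReal D := by
    simpa using (ENNReal.le_tsum (f := fun k : ℤ => ‖g (x - k)‖ₑ) 0).trans hx
  rw [← ofReal_norm, Real.norm_eq_abs, ENNReal.ofReal_le_ofReal_iff'] at hterm
  exact le_max_iff.2 hterm

lemma FatherRegular.memLp_top (h : FatherRegular N φ) (hφ : AEStronglyMeasurable φ volume) :
    MemLp φ ∞ := by
  obtain ⟨Φ, -, ⟨B, hB⟩, hΦ, -⟩ := h.decay
  exact memLp_top_of_bound hφ B (.of_forall fun x =>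
    (hΦ x).trans ((le_abs_self _).trans (hB _ (abs_nonneg _))))

/-- The analytic content of a wavelet pair, for everywhere bounded measurable representatives.
Unlike `IsWaveletPair` it does not mention the spaces `V_j`. -/
structure IsBoundedPair (N : ℕ) (A B : ℝ) (φ ψ : ℝ → ℝ) : Prop where
  radius_pos : 0 < A
  father : IsBddSupported A B φ
  mother : IsBddSupported A B ψ
  father_norm : ∫ x, φ x * φ x = 1
  father_mother : ∀ (j : ℕ) (k l : ℤ), ∫ x, dyadic φ 0 k x * dyadic ψ j l x = 0
  mother_mother : ∀ i j k l : ℤ,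
    ∫ x, dyadic ψ i k x * dyadic ψ j l x = if i = j ∧ k = l then 1 else 0
  weakDeriv : ∃ g, IsWeakDeriv (N + 1) φ g ∧ ∃ D : ℝ, ∀ᵐ x, |g x| ≤ D

lemma IsWaveletPair.exists_isBoundedPair (h : IsWaveletPair N φ ψ) :
    ∃ (A B : ℝ) (φ' ψ' : ℝ → ℝ),
      IsBoundedPair N A B φ' ψ' ∧ φ =ᵐ[volume] φ' ∧ ψ =ᵐ[volume] ψ' := by
  obtain ⟨A, hA⟩ := h.compact
  have hφ_top := h.regular.memLp_top h.mra.orthonormal.1.1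
  have hψ_top := h.mother.memLp_top h.mra.orthonormal hA hφ_top
  obtain ⟨B₁, φ', hφ', hφe⟩ := exists_isBddSupported_ae_eq hφ_top fun x hx => (hA x hx).1
  obtain ⟨B₂, ψ', hψ', hψe⟩ := exists_isBddSupported_ae_eq hψ_top fun x hx => (hA x hx).2
  have hcongr {f f' g g' : ℝ → ℝ} (hf : f =ᵐ[volume] f') (hg : g =ᵐ[volume] g') (i j k l : ℤ) :
      ∫ x, dyadic f' i k x * dyadic g' j l x = ∫ x, dyadic f i k x * dyadic g j l x :=
    integral_congr_ae ((dyadic_ae_congr hf i k).symm.mul (dyadic_ae_congr hg j l).symm)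
  refine ⟨max A 1, max B₁ B₂, φ', ψ', ?_, hφe, hψe⟩
  exact
    { radius_pos := lt_max_of_lt_right one_pos
      father := hφ'.mono (le_max_left _ _) (le_max_left _ _)
      mother := hψ'.mono (le_max_left _ _) (le_max_right _ _)
      father_norm := by
        have hnorm := (hcongr hφe hφe 0 0 0 0).trans (h.mra.orthonormal.2 0 0)
        simpa only [dyadic_zero, Int.cast_zero, sub_zero, if_true] using hnorm
      father_mother := fun j k l => (hcongr hφe hψe 0 j k l).trans
        (integral_father_mul_mother h.mra h.mother (Int.natCast_nonneg j) k l)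
      mother_mother := fun i j k l => (hcongr hψe hψe i j k l).trans
        (integral_mother_mul_mother h.mra h.mother i j k l)
      weakDeriv := by
        obtain ⟨g, hg, D, hD⟩ := h.regular.weakDeriv
        exact ⟨g, hg.congr_left hφe, _, ae_abs_le_of_tsum_translates_le hD⟩ }

lemma besovJ_congr {φ' ψ' : ℝ → ℝ} (hφ : φ =ᵐ[volume] φ') (hψ : ψ =ᵐ[volume] ψ') :
    besovJ φ ψ = besovJ φ' ψ' := by
  funext s p q f
  simp only [besovJ, waveletCoeff_congr hφ, waveletCoeff_congr hψ]

lemma densityClass_congr {φ' ψ' : ℝ → ℝ} (hφ : φ =ᵐ[volume] φ') (hψ : ψ =ᵐ[volume] ψ') :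
    densityClass φ ψ = densityClass φ' ψ' := by
  funext s p q L T
  simp only [densityClass, besovJ_congr hφ hψ]

end Representatives

/-! ### Smooth functions with compact support -/

/-- `F` is smooth, vanishes off `[-R, R]`, and its derivative of order `m` is bounded by `D`. -/
structure IsSmoothSupported (m : ℕ) (R D : ℝ) (F : ℝ → ℝ) : Prop where
  contDiff : ContDiff ℝ (⊤ : ℕ∞) F
  eq_zero : ∀ x, R < |x| → F x = 0
  abs_iteratedDeriv_le : ∀ x, |iteratedDeriv m F x| ≤ D

section Smooth

variable {F G : ℝ → ℝ} {R D : ℝ} {m : ℕ}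

lemma abs_le_of_abs_deriv_le (hG : Differentiable ℝ G) (hR : 0 ≤ R)
    (hzero : ∀ x, R < |x| → G x = 0) (hD : ∀ x, |deriv G x| ≤ D) (x : ℝ) :
    |G x| ≤ D * (2 * R + 2) := by
  have hD0 : 0 ≤ D := (abs_nonneg _).trans (hD 0)
  rcases lt_or_ge R |x| with hx | hx
  · rw [hzero x hx, abs_zero]
    positivity
  · have hend : G (-R - 1) = 0 := hzero _ (by rw [abs_of_neg (by linarith)]; linarith)
    have hmean := Convex.norm_image_sub_le_of_norm_deriv_le (fun y _ => hG y) (fun y _ => hD y)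
      convex_univ (Set.mem_univ (-R - 1)) (Set.mem_univ x)
    rw [hend, sub_zero, Real.norm_eq_abs, Real.norm_eq_abs] at hmean
    refine hmean.trans ?_
    gcongr
    rw [abs_le] at hx ⊢
    constructor <;> linarith

lemma iteratedDeriv_eq_zero_of_lt_abs (hzero : ∀ x, R < |x| → G x = 0) (n : ℕ) {x : ℝ}
    (hx : R < |x|) : iteratedDeriv n G x = 0 := by
  have hopen : IsOpen {x : ℝ | R < |x|} := isOpen_lt continuous_const continuous_abs
  have hconst : Set.EqOn G (fun _ => 0) {x | R < |x|} := hzero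
  rw [hconst.iteratedDeriv_of_isOpen hopen n hx, iteratedDeriv_const, ite_self]

lemma IsSmoothSupported.abs_iteratedDeriv_le_of_add_eq {i k : ℕ} (hF : IsSmoothSupported m R D F)
    (hR : 0 ≤ R) (hik : i + k = m) (x : ℝ) : |iteratedDeriv i F x| ≤ D * (2 * R + 2) ^ k := by
  induction k generalizing i x with
  | zero =>
    obtain rfl : i = m := by simpa using hik
    simpa using hF.abs_iteratedDeriv_le x
  | succ k ih =>
    have hderiv : ∀ x, |deriv (iteratedDeriv i F) x| ≤ D * (2 * R + 2) ^ k := fun x => by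
      rw [← iteratedDeriv_succ]
      exact ih (by omega) x
    rw [pow_succ, ← mul_assoc]
    exact abs_le_of_abs_deriv_le
      (hF.contDiff.differentiable_iteratedDeriv i (by exact_mod_cast WithTop.coe_lt_top i)) hR
      (fun x hx => iteratedDeriv_eq_zero_of_lt_abs hF.eq_zero i hx) hderiv x

lemma abs_sub_taylor_le (hF : ContDiff ℝ (⊤ : ℕ∞) F) (hD : ∀ x, |iteratedDeriv (m + 1) F x| ≤ D)
    (t u : ℝ) :
    |F (t + u) - ∑ i ∈ Finset.range (m + 1), iteratedDeriv i F t * u ^ i / i.factorial| ≤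
      D * |u| ^ (m + 1) := by
  rcases eq_or_ne u 0 with rfl | hu
  · rw [Finset.sum_range_succ']
    simp
  have hne : t ≠ t + u := by simpa using hu
  have hn (n : ℕ) : ContDiff ℝ n F := hF.of_le (by exact_mod_cast le_top)
  obtain ⟨z, -, hz⟩ := taylor_mean_remainder_lagrange_iteratedDeriv hne (hn (m + 1)).contDiffOn
  have htaylor : taylorWithinEval F m (Set.uIcc t (t + u)) t (t + u) =
      ∑ i ∈ Finset.range (m + 1), iteratedDeriv i F t * u ^ i / i.factorial := by
    rw [taylor_within_apply]
    refine Finset.sum_congr rfl fun i _ => ?_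
    rw [iteratedDerivWithin_eq_iteratedDeriv (uniqueDiffOn_uIcc hne) (hn i).contDiffAt
      Set.left_mem_uIcc, add_sub_cancel_left, smul_eq_mul]
    ring
  have hfactorial : (1 : ℝ) ≤ |((m + 1).factorial : ℝ)| := by
    rw [Nat.abs_cast]
    exact_mod_cast Nat.succ_le_of_lt (Nat.factorial_pos _)
  rw [htaylor, add_sub_cancel_left] at hz
  rw [hz, abs_div, abs_mul, abs_pow]
  exact (div_le_self (by positivity) hfactorial).trans (by gcongr; exact hD z)

lemma integral_taylor_mul {A B : ℝ} {ψ : ℝ → ℝ} (hψ : IsBddSupported A B ψ)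
    (hmom : ∀ i < m, ∫ y, y ^ i * ψ y = 0) (c : ℕ → ℝ) (δ : ℝ) :
    ∫ y, (∑ i ∈ Finset.range (m + 1), c i * (δ * y) ^ i / i.factorial) * ψ y =
      c m * δ ^ m / m.factorial * ∫ y, y ^ m * ψ y := by
  have hexpand : ∀ y, (∑ i ∈ Finset.range (m + 1), c i * (δ * y) ^ i / i.factorial) * ψ y =
      ∑ i ∈ Finset.range (m + 1), c i * δ ^ i / i.factorial * (y ^ i * ψ y) := by
    intro y
    rw [Finset.sum_mul]
    refine Finset.sum_congr rfl fun i _ => ?_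
    rw [mul_pow]
    ring
  simp_rw [hexpand]
  rw [integral_finsetSum _ fun i _ => (hψ.integrable_continuous_mul (by fun_prop)).const_mul _]
  simp_rw [integral_const_mul]
  rw [Finset.sum_range_succ, Finset.sum_eq_zero, zero_add]
  intro i hi
  rw [hmom i (Finset.mem_range.1 hi), mul_zero]

lemma abs_integral_dilation_mul_sub_moment_le (hF : ContDiff ℝ (⊤ : ℕ∞) F)
    (hD : ∀ x, |iteratedDeriv (m + 1) F x| ≤ D) {A B : ℝ} {ψ : ℝ → ℝ}
    (hψ : IsBddSupported A B ψ) (hmom : ∀ i < m, ∫ y, y ^ i * ψ y = 0) (t : ℝ) {δ : ℝ}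
    (hδ : 0 ≤ δ) :
    |(∫ y, F (t + δ * y) * ψ y) -
        iteratedDeriv m F t * δ ^ m / m.factorial * ∫ y, y ^ m * ψ y| ≤
      D * δ ^ (m + 1) * ∫ y, |y| ^ (m + 1) * |ψ y| := by
  have hFc : Continuous F := hF.continuous
  have habs : Integrable fun y => |y| ^ (m + 1) * |ψ y| := by
    refine (hψ.integrable_continuous_mul (G := fun y => |y| ^ (m + 1)) (by fun_prop)).abs.congr
      (.of_forall fun y => ?_)
    simp only [abs_mul, abs_pow, abs_abs]
  rw [← integral_taylor_mul hψ hmom fun i => iteratedDeriv i F t,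
    ← integral_sub (hψ.integrable_continuous_mul (by fun_prop))
      (hψ.integrable_continuous_mul (by fun_prop)), ← integral_const_mul]
  rw [← Real.norm_eq_abs]
  refine norm_integral_le_of_norm_le (habs.const_mul _) (.of_forall fun y => ?_)
  have htaylor := abs_sub_taylor_le hF hD t (δ * y)
  rw [abs_mul δ y, abs_of_nonneg hδ, mul_pow] at htaylor
  rw [Real.norm_eq_abs, ← sub_mul, abs_mul]
  exact (mul_le_mul_of_nonneg_right htaylor (abs_nonneg _)).trans_eq (by ring)

end Smooth

/-! ### Mollification -/

section Mollification

open scoped Convolution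

variable {ρ φ g : ℝ → ℝ} {M : ℕ} {A B D : ℝ}

lemma abs_integral_mul_le_of_integral_eq_one {Ω : Type*} [MeasurableSpace Ω] {μ : Measure Ω}
    {ρ g : Ω → ℝ} (hρ : ∀ x, 0 ≤ ρ x) (hρ1 : ∫ x, ρ x ∂μ = 1)
    (hg : ∀ᵐ x ∂μ, |g x| ≤ D) : |∫ x, g x * ρ x ∂μ| ≤ D := by
  have hρi : Integrable ρ μ := .of_integral_ne_zero (by simp [hρ1])
  calc |∫ x, g x * ρ x ∂μ| ≤ ∫ x, D * ρ x ∂μ := by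
        rw [← Real.norm_eq_abs]
        refine norm_integral_le_of_norm_le (hρi.const_mul D) ?_
        filter_upwards [hg] with x hx
        rw [norm_mul, Real.norm_of_nonneg (hρ x)]
        exact mul_le_mul_of_nonneg_right hx (hρ x)
    _ = D := by rw [integral_const_mul, hρ1, mul_one]

lemma convolution_eq_zero (hρ : ∀ x, 1 < |x| → ρ x = 0) (hφ : ∀ x, A < |x| → φ x = 0) {x : ℝ}
    (hx : A + 1 < |x|) : (ρ ⋆[ContinuousLinearMap.lsmul ℝ ℝ] φ) x = 0 := by
  refine integral_eq_zero_of_ae (.of_forall fun t => ?_)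
  rcases lt_or_ge 1 |t| with ht | ht
  · simp [hρ t ht]
  · have hdist := abs_sub_abs_le_abs_sub x t
    simp [hφ (x - t) (by linarith)]

lemma iteratedDeriv_convolution (hρ : ContDiff ℝ (⊤ : ℕ∞) ρ) (hρc : HasCompactSupport ρ)
    (hφ : LocallyIntegrable φ) (n : ℕ) :
    iteratedDeriv n (ρ ⋆[ContinuousLinearMap.lsmul ℝ ℝ] φ) =
      iteratedDeriv n ρ ⋆[ContinuousLinearMap.lsmul ℝ ℝ] φ := by
  induction n generalizing ρ with
  | zero => simp
  | succ n ih =>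
    rw [iteratedDeriv_succ', iteratedDeriv_succ', ← ih (contDiff_infty_iff_deriv.1 hρ).2 hρc.deriv]
    congr 1
    funext x
    exact (hρc.hasDerivAt_convolution_left _ (hρ.of_le (by exact_mod_cast le_top)) hφ x).deriv

lemma IsWeakDeriv.iteratedDeriv_convolution_apply (hg : IsWeakDeriv M φ g)
    (hρ : ContDiff ℝ (⊤ : ℕ∞) ρ) (hρc : HasCompactSupport ρ) (x : ℝ) :
    iteratedDeriv M (ρ ⋆[ContinuousLinearMap.lsmul ℝ ℝ] φ) x = ∫ t, g t * ρ (x - t) := by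
  have hweak := hg.2.2 (fun t => ρ (x - t)) (hρ.comp (contDiff_const.sub contDiff_id))
    (hρc.comp_homeomorph (Homeomorph.subLeft x))
  have hsign : ∀ t, φ t * (-1 : ℝ) ^ M • iteratedDeriv M ρ (x - t) =
      (-1) ^ M * (iteratedDeriv M ρ (x - t) * φ t) := fun t => by
    rw [smul_eq_mul]
    ring
  simp_rw [iteratedDeriv_comp_const_sub, hsign] at hweak
  rw [integral_const_mul] at hweak
  rw [iteratedDeriv_convolution hρ hρc hg.1, convolution_eq_swap]
  simp only [ContinuousLinearMap.lsmul_apply, smul_eq_mul]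
  exact mul_left_cancel₀ (pow_ne_zero _ (by norm_num)) hweak

lemma isSmoothSupported_convolution (hρ : ContDiff ℝ (⊤ : ℕ∞) ρ) (hρ0 : ∀ x, 0 ≤ ρ x)
    (hρ1 : ∫ x, ρ x = 1) (hρs : ∀ x, 1 < |x| → ρ x = 0) (hφ : ∀ x, A < |x| → φ x = 0)
    (hg : IsWeakDeriv M φ g) (hD : ∀ᵐ x, |g x| ≤ D) :
    IsSmoothSupported M (A + 1) D (ρ ⋆[ContinuousLinearMap.lsmul ℝ ℝ] φ) := by
  have hρc : HasCompactSupport ρ :=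
    .of_support_subset_isCompact isCompact_Icc (support_subset_Icc hρs)
  refine ⟨hρc.contDiff_convolution_left _ hρ hg.1, fun x => convolution_eq_zero hρs hφ,
    fun x => ?_⟩
  rw [hg.iteratedDeriv_convolution_apply hρ hρc]
  exact abs_integral_mul_le_of_integral_eq_one (fun t => hρ0 (x - t))
    ((integral_sub_left_eq_self ρ volume x).trans hρ1) hD

lemma abs_convolution_le (hρ0 : ∀ x, 0 ≤ ρ x) (hρ1 : ∫ x, ρ x = 1) (hφ : ∀ x, |φ x| ≤ B)
    (x : ℝ) : |(ρ ⋆[ContinuousLinearMap.lsmul ℝ ℝ] φ) x| ≤ B := by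
  simp only [convolution_def, ContinuousLinearMap.lsmul_apply, smul_eq_mul, mul_comm (ρ _)]
  exact abs_integral_mul_le_of_integral_eq_one hρ0 hρ1 (.of_forall fun t => hφ _)

lemma tendsto_integral_abs_sub_of_isBddSupported {F : ℕ → ℝ → ℝ}
    (hF : ∀ i, IsBddSupported A B (F i)) (hφ : IsBddSupported A B φ)
    (hlim : ∀ᵐ x, Filter.Tendsto (F · x) .atTop (nhds (φ x))) :
    Filter.Tendsto (fun i => ∫ x, |F i x - φ x|) .atTop (nhds 0) := by
  rw [← integral_zero ℝ ℝ (μ := volume)]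
  refine tendsto_integral_of_dominated_convergence
    (Set.indicator (Set.Icc (-A) A) fun _ => B + B)
    (fun i => ((hF i).measurable.sub hφ.measurable).abs.aestronglyMeasurable)
    ((integrable_indicator_iff measurableSet_Icc).2 continuous_const.integrableOn_Icc)
    (fun i => .of_forall fun x => ?_) ?_
  · rw [Real.norm_eq_abs, abs_abs]
    by_cases hx : x ∈ Set.Icc (-A) A
    · rw [Set.indicator_of_mem hx]
      exact (abs_sub _ _).trans (add_le_add ((hF i).abs_le x) (hφ.abs_le x))
    · rw [Set.indicator_of_notMem hx]
      rw [Set.mem_Icc, ← abs_le, not_le] at hx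
      simp [(hF i).eq_zero x hx, hφ.eq_zero x hx]
  · filter_upwards [hlim] with x hx
    simpa using (hx.sub_const (φ x)).abs

/-- The bump functions supported in the balls of radius `1 / (i + 1)` about `0`. -/
noncomputable def shrinkingBump (i : ℕ) : ContDiffBump (0 : ℝ) where
  rIn := 1 / (2 * ((i : ℝ) + 1))
  rOut := 1 / ((i : ℝ) + 1)
  rIn_pos := by positivity
  rIn_lt_rOut := by
    have : (0 : ℝ) < (i : ℝ) + 1 := by positivity
    gcongr
    linarith

lemma exists_smooth_approximation (hφ : IsBddSupported A B φ) (hg : IsWeakDeriv M φ g)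
    (hD : ∀ᵐ x, |g x| ≤ D) :
    ∃ F : ℕ → ℝ → ℝ, (∀ i, IsSmoothSupported M (A + 1) D (F i)) ∧
      (∀ᵐ x, Filter.Tendsto (F · x) .atTop (nhds (φ x))) ∧
      Filter.Tendsto (fun i => ∫ x, |F i x - φ x|) .atTop (nhds 0) := by
  set b := shrinkingBump
  have hbump : ∀ i x, 1 < |x| → (b i).normed volume x = 0 := by
    intro i x hx
    rw [← Function.notMem_support, (b i).support_normed_eq, Metric.mem_ball, dist_zero_right,
      not_lt]
    exact (div_le_one_of_le₀ (by simp) (by positivity)).trans hx.le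
  set F : ℕ → ℝ → ℝ := fun i => (b i).normed volume ⋆[ContinuousLinearMap.lsmul ℝ ℝ] φ
  have hF : ∀ i, IsSmoothSupported M (A + 1) D (F i) := fun i =>
    isSmoothSupported_convolution (b i).contDiff_normed (b i).nonneg_normed (b i).integral_normed
      (hbump i) hφ.eq_zero hg hD
  have hlim : ∀ᵐ x, Filter.Tendsto (F · x) .atTop (nhds (φ x)) := by
    refine ContDiffBump.ae_convolution_tendsto_right_of_locallyIntegrable (K := 2)
      tendsto_one_div_add_atTop_nhds_zero_nat (.of_forall fun i => le_of_eq ?_) hg.1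
    change 1 / ((i : ℝ) + 1) = 2 * (1 / (2 * ((i : ℝ) + 1)))
    field_simp
  refine ⟨F, hF, hlim, tendsto_integral_abs_sub_of_isBddSupported (fun i => ?_)
    (hφ.mono (le_add_of_nonneg_right zero_le_one) le_rfl) hlim⟩
  exact ⟨(hF i).contDiff.continuous.measurable,
    abs_convolution_le (b i).nonneg_normed (b i).integral_normed hφ.abs_le, (hF i).eq_zero⟩

end Mollification

/-! ### Vanishing moments -/

section VanishingMoments

variable {A B C R D : ℝ} {F G φ ψ : ℝ → ℝ} {m M : ℕ}

lemma abs_integral_mul_le_of_integral_mul_dyadic_eq_zero (hψ : IsBddSupported A B ψ)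
    (hF : Integrable F) (hG : Integrable G) {j k : ℤ} (hGψ : ∫ x, G x * dyadic ψ j k x = 0) :
    |∫ y, F (2 ^ (-j) * k + 2 ^ (-j) * y) * ψ y| ≤ 2 ^ j * B * ∫ x, |F x - G x| := by
  set c : ℝ := 2 ^ ((j : ℝ) / 2)
  have hψm : AEStronglyMeasurable (dyadic ψ j k) volume :=
    (memLp_dyadic hψ.memLp_top j k).1
  have hbound : ∀ x, |dyadic ψ j k x| ≤ c * B := abs_dyadic_le hψ.abs_le j k
  have hint {H : ℝ → ℝ} (hH : Integrable H) : Integrable fun x => H x * dyadic ψ j k x :=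
    hH.mul_bdd hψm (.of_forall hbound)
  have hsub : ∫ x, F x * dyadic ψ j k x = ∫ x, (F x - G x) * dyadic ψ j k x := by
    simp_rw [sub_mul]
    rw [integral_sub (hint hF) (hint hG), hGψ, sub_zero]
  have hcoeff : |∫ x, F x * dyadic ψ j k x| ≤ (∫ x, |F x - G x|) * (c * B) := by
    rw [hsub, ← Real.norm_eq_abs, ← integral_mul_const]
    refine norm_integral_le_of_norm_le ((hF.sub hG).abs.mul_const _) (.of_forall fun x => ?_)
    rw [norm_mul]
    exact mul_le_mul_of_nonneg_left (hbound x) (norm_nonneg _)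
  have hrescale : ∫ y, F (2 ^ (-j) * k + 2 ^ (-j) * y) * ψ y =
      c * ∫ x, F x * dyadic ψ j k x := by
    rw [integral_mul_dyadic, ← mul_assoc, ← Real.rpow_add two_pos, neg_div, add_neg_cancel,
      Real.rpow_zero, one_mul]
  rw [hrescale, abs_mul, abs_of_pos (by positivity), ← two_rpow_half_sq]
  calc c * |∫ x, F x * dyadic ψ j k x| ≤ c * ((∫ x, |F x - G x|) * (c * B)) := by gcongr
    _ = c ^ 2 * B * ∫ x, |F x - G x| := by ring

lemma abs_iteratedDeriv_mul_abs_moment_le (hF : ContDiff ℝ (⊤ : ℕ∞) F)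
    (hC : ∀ x, |iteratedDeriv (m + 1) F x| ≤ C) (hψ : IsBddSupported A B ψ)
    (hmom : ∀ i < m, ∫ y, y ^ i * ψ y = 0) (t : ℝ) {δ : ℝ} (hδ : 0 < δ) :
    |iteratedDeriv m F t| * |∫ y, y ^ m * ψ y| ≤
      m.factorial * (δ⁻¹ ^ m * |∫ y, F (t + δ * y) * ψ y| +
        C * (∫ y, |y| ^ (m + 1) * |ψ y|) * δ) := by
  have htaylor := abs_integral_dilation_mul_sub_moment_le hF hC hψ hmom t hδ.le
  set I := ∫ y, F (t + δ * y) * ψ y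
  set K := ∫ y, |y| ^ (m + 1) * |ψ y|
  set μ := ∫ y, y ^ m * ψ y
  have hmain : |iteratedDeriv m F t * δ ^ m / m.factorial * μ| ≤ |I| + C * δ ^ (m + 1) * K := by
    linarith [abs_sub_abs_le_abs_sub (iteratedDeriv m F t * δ ^ m / m.factorial * μ) I,
      abs_sub_comm (iteratedDeriv m F t * δ ^ m / m.factorial * μ) I]
  have hscale : |iteratedDeriv m F t| * |μ| =
      m.factorial * δ⁻¹ ^ m * |iteratedDeriv m F t * δ ^ m / m.factorial * μ| := by
    rw [abs_mul, abs_div, abs_mul, abs_of_pos (pow_pos hδ m), Nat.abs_cast, inv_pow]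
    field_simp
  calc |iteratedDeriv m F t| * |μ| ≤ m.factorial * δ⁻¹ ^ m * (|I| + C * δ ^ (m + 1) * K) := by
        rw [hscale]
        gcongr
    _ = m.factorial * (δ⁻¹ ^ m * |I| + C * K * δ) := by
        rw [inv_pow, pow_succ]
        field_simp

lemma abs_le_of_abs_le_grid {b δ : ℝ} (hG : Differentiable ℝ G) (hC : ∀ x, |deriv G x| ≤ C)
    (hδ : 0 < δ) (hb : ∀ k : ℤ, |G (δ * k)| ≤ b) (x : ℝ) : |G x| ≤ b + C * δ := by
  have hC0 : 0 ≤ C := (abs_nonneg _).trans (hC 0)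
  have hfloor := Int.floor_le (x / δ)
  have hfloor' := Int.lt_floor_add_one (x / δ)
  rw [le_div_iff₀ hδ] at hfloor
  rw [div_lt_iff₀ hδ] at hfloor'
  have hdist : |x - δ * ⌊x / δ⌋| ≤ δ := by
    rw [abs_le]
    constructor <;> linarith
  have hmean := Convex.norm_image_sub_le_of_norm_deriv_le (fun y _ => hG y) (fun y _ => hC y)
    convex_univ (Set.mem_univ (δ * ⌊x / δ⌋)) (Set.mem_univ x)
  rw [Real.norm_eq_abs, Real.norm_eq_abs] at hmean
  linarith [abs_sub_abs_le_abs_sub (G x) (G (δ * ⌊x / δ⌋)), hb ⌊x / δ⌋,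
    mul_le_mul_of_nonneg_left hdist hC0]

lemma IsSmoothSupported.abs_mul_abs_moment_le (hF : IsSmoothSupported M R D F) (hR : 0 ≤ R)
    (hm : m < M) (hG : Integrable G) (hψ : IsBddSupported A B ψ)
    (hmom : ∀ i < m, ∫ y, y ^ i * ψ y = 0) {j : ℤ}
    (hGψ : ∀ k, ∫ x, G x * dyadic ψ j k x = 0) (x : ℝ) :
    |F x| * |∫ y, y ^ m * ψ y| ≤
      (m.factorial * ((2 ^ j) ^ (m + 1) * B * (∫ x, |F x - G x|) +
          D * (2 * R + 2) ^ (M - (m + 1)) * (∫ y, |y| ^ (m + 1) * |ψ y|) * 2 ^ (-j)) +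
        D * (2 * R + 2) ^ (M - (m + 1)) * |∫ y, y ^ m * ψ y| * 2 ^ (-j)) *
      (2 * R + 2) ^ m := by
  set C := D * (2 * R + 2) ^ (M - (m + 1))
  set K := ∫ y, |y| ^ (m + 1) * |ψ y|
  set μ := ∫ y, y ^ m * ψ y
  have hFi : Integrable F := hF.contDiff.continuous.integrable_of_hasCompactSupport
    (.of_support_subset_isCompact isCompact_Icc (support_subset_Icc hF.eq_zero))
  have hC : ∀ x, |iteratedDeriv (m + 1) F x| ≤ C :=
    hF.abs_iteratedDeriv_le_of_add_eq hR (by omega)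
  have hδ : (0 : ℝ) < 2 ^ (-j) := by positivity
  set b := m.factorial * ((2 ^ j) ^ (m + 1) * B * (∫ x, |F x - G x|) + C * K * 2 ^ (-j))
  have hgrid : ∀ k : ℤ, |iteratedDeriv m F (2 ^ (-j) * k) * μ| ≤ b := fun k => by
    rw [abs_mul]
    refine (abs_iteratedDeriv_mul_abs_moment_le hF.contDiff hC hψ hmom _ hδ).trans ?_
    have horth := abs_integral_mul_le_of_integral_mul_dyadic_eq_zero hψ hFi hG (hGψ k)
    rw [zpow_neg, inv_inv, ← zpow_neg]
    calc _ ≤ m.factorial * ((2 ^ j) ^ m * (2 ^ j * B * ∫ x, |F x - G x|) + C * K * 2 ^ (-j)) := by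
          gcongr
      _ = b := by ring
  have hderiv : ∀ t, |iteratedDeriv m F t * μ| ≤ b + C * |μ| * 2 ^ (-j) :=
    abs_le_of_abs_le_grid
      ((hF.contDiff.differentiable_iteratedDeriv m
        (by exact_mod_cast WithTop.coe_lt_top m)).mul_const μ)
      (fun t => by
        rw [deriv_mul_const_field, abs_mul, ← iteratedDeriv_succ]
        exact mul_le_mul_of_nonneg_right (hC t) (abs_nonneg μ)) hδ hgrid
  have hFμ : IsSmoothSupported m R (b + C * |μ| * 2 ^ (-j)) fun x => F x * μ :=
    ⟨hF.contDiff.mul contDiff_const, fun x hx => by rw [hF.eq_zero x hx, zero_mul], fun t => by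
      simpa only [mul_comm _ μ, iteratedDeriv_const_mul_field] using hderiv t⟩
  simpa [abs_mul] using hFμ.abs_iteratedDeriv_le_of_add_eq hR (zero_add m) x

end VanishingMoments

namespace IsBoundedPair

variable {N : ℕ} {A B : ℝ} {φ ψ : ℝ → ℝ}

lemma moment_eq_zero (h : IsBoundedPair N A B φ ψ) {m : ℕ} (hm : m ≤ N) :
    ∫ y, y ^ m * ψ y = 0 := by
  induction m using Nat.strong_induction_on with
  | _ m ih =>
  by_contra hμ
  set μ := ∫ y, y ^ m * ψ y
  obtain ⟨g, hg, D, hD⟩ := h.weakDeriv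
  obtain ⟨F, hF, hlim, hL1⟩ := exists_smooth_approximation h.father hg hD
  have hA : 0 ≤ A + 1 := by linarith [h.radius_pos]
  have hφ : ∀ᵐ x, φ x = 0 := by
    filter_upwards [hlim] with x hx
    have hlevel (j : ℕ) := le_of_tendsto_of_tendsto' (hx.abs.mul_const |μ|)
      (((((hL1.const_mul _).add_const _).const_mul _).add_const _).mul_const _) fun i =>
        (hF i).abs_mul_abs_moment_le hA (Nat.lt_succ_of_le hm) h.father.integrable h.mother
          (fun l hl => ih l hl (hl.le.trans hm)) (j := j)
          (fun k => by simpa [dyadic_zero] using h.father_mother j 0 k) x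
    have hδ : Filter.Tendsto (fun j : ℕ => (2 : ℝ) ^ (-(j : ℤ))) .atTop (nhds 0) := by
      simp only [zpow_neg, zpow_natCast]
      exact (tendsto_pow_atTop_atTop_of_one_lt one_lt_two).inv_tendsto_atTop
    simp only [mul_zero, zero_add] at hlevel
    have hle := ge_of_tendsto' ((((hδ.const_mul _).const_mul _).add (hδ.const_mul _)).mul_const _)
      hlevel
    have hzero : |φ x| * |μ| ≤ 0 := by simpa using hle
    exact abs_eq_zero.1 (le_antisymm
      (nonpos_of_mul_nonpos_left hzero (abs_pos.2 hμ)) (abs_nonneg _))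
  have hnorm : ∫ x, φ x * φ x = 0 :=
    integral_eq_zero_of_ae (hφ.mono fun x hx => by simp [hx])
  exact one_ne_zero (h.father_norm.symm.trans hnorm)

lemma integral_mother_eq_zero (h : IsBoundedPair N A B φ ψ) : ∫ y, ψ y = 0 := by
  simpa using h.moment_eq_zero (Nat.zero_le N)

lemma abs_waveletCoeff_mother_le (h : IsBoundedPair N A B φ ψ) {f : ℝ → ℝ} {D : ℝ}
    (hf : ContDiff ℝ (⊤ : ℕ∞) f) (hD : ∀ x, |iteratedDeriv (N + 1) f x| ≤ D) (j k : ℤ) :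
    |waveletCoeff ψ f j k| ≤
      2 ^ (-(j : ℝ) / 2) * (D * (2 ^ (-j)) ^ (N + 1) * ∫ y, |y| ^ (N + 1) * |ψ y|) := by
  have htaylor := abs_integral_dilation_mul_sub_moment_le hf hD h.mother
    (fun i hi => h.moment_eq_zero hi.le) (2 ^ (-j) * k) (δ := 2 ^ (-j)) (by positivity)
  rw [h.moment_eq_zero le_rfl, mul_zero, sub_zero] at htaylor
  rw [waveletCoeff, integral_mul_dyadic, abs_mul, abs_of_pos (by positivity)]
  gcongr

end IsBoundedPair

/-! ### The Besov norm -/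

section SequenceNorms

lemma eLpNorm_count_le_of_finset {ι ε : Type*} [MeasurableSpace ι] [MeasurableSingletonClass ι]
    [TopologicalSpace ε] [ENormedAddMonoid ε] {f : ι → ε} {C : ℝ≥0∞} (S : Finset ι) (p : ℝ≥0∞)
    (hS : ∀ i ∉ S, f i = 0) (hC : ∀ i, ‖f i‖ₑ ≤ C) :
    eLpNorm f p Measure.count ≤ C * (S.card : ℝ≥0∞) ^ (1 / p).toReal := by
  have hsupp : f.support ⊆ S := fun i hi => by_contra fun hiS => hi (hS i hiS)
  rw [← eLpNorm_restrict_eq_of_support_subset hsupp]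
  refine (eLpNorm_le_of_ae_enorm_bound (.of_forall hC)).trans_eq ?_
  rw [Measure.restrict_apply MeasurableSet.univ, Set.univ_inter, Measure.count_apply_finset,
    smul_eq_mul, one_div, ENNReal.toReal_inv]

lemma eLpNorm_count_single_le {ι ε : Type*} [MeasurableSpace ι] [MeasurableSingletonClass ι]
    [DecidableEq ι] [TopologicalSpace ε] [ENormedAddMonoid ε] (i : ι) (c : ε) (p : ℝ≥0∞) :
    eLpNorm (Pi.single i c : ι → ε) p Measure.count ≤ ‖c‖ₑ := by
  refine (eLpNorm_count_le_of_finset (C := ‖c‖ₑ) {i} p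
    (fun l hl => by rw [Pi.single_eq_of_ne (by simpa using hl)]) fun l => ?_).trans (by simp)
  rcases eq_or_ne l i with rfl | hl
  · rw [Pi.single_eq_same]
  · rw [Pi.single_eq_of_ne hl, enorm_zero]
    exact zero_le

lemma eLpNorm_count_lt_top_of_le_geometric {a : ℕ → ℝ≥0∞} {q : ℝ≥0∞} (hq : 1 ≤ q) {c ρ : ℝ}
    (hc : 0 ≤ c) (hρ : 0 ≤ ρ) (hρ1 : ρ < 1) (ha : ∀ j, a j ≤ ENNReal.ofReal (c * ρ ^ j)) :
    eLpNorm a q Measure.count < ∞ := by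
  have hq0 : q ≠ 0 := (one_pos.trans_le hq).ne'
  rcases eq_or_ne q ∞ with rfl | hqt
  · refine (eLpNorm_le_of_ae_enorm_bound (C := ENNReal.ofReal c)
      (.of_forall fun j => (ha j).trans (ENNReal.ofReal_le_ofReal ?_))).trans_lt (by simp)
    exact mul_le_of_le_one_right hc (pow_le_one₀ hρ hρ1.le)
  · have hq1 : 0 < q.toReal := ENNReal.toReal_pos hq0 hqt
    have hsum : Summable fun j : ℕ => c ^ q.toReal * (ρ ^ q.toReal) ^ j :=
      (summable_geometric_of_lt_one (Real.rpow_nonneg hρ _)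
        (Real.rpow_lt_one hρ hρ1 hq1)).mul_left _
    rw [eLpNorm_lt_top_iff_lintegral_rpow_enorm_lt_top hq0 hqt, lintegral_count]
    refine (ENNReal.tsum_le_tsum fun j => ?_).trans_lt hsum.tsum_ofReal_lt_top
    rw [enorm_eq_self]
    refine (ENNReal.rpow_le_rpow (ha j) hq1.le).trans_eq ?_
    rw [ENNReal.ofReal_rpow_of_nonneg (by positivity) hq1.le, Real.mul_rpow hc (by positivity),
      ← Real.rpow_natCast, ← Real.rpow_natCast, ← Real.rpow_mul hρ, ← Real.rpow_mul hρ,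
      mul_comm (j : ℝ)]

lemma two_rpow_eq_ofReal (x : ℝ) : (2 : ℝ≥0∞) ^ x = ENNReal.ofReal ((2 : ℝ) ^ x) := by
  rw [← ENNReal.ofReal_rpow_of_pos two_pos]
  simp

end SequenceNorms

section BesovNorm

variable {f f' g φ ψ : ℝ → ℝ} {A T : ℝ}

lemma card_translatesMeeting_le (hA : 0 ≤ A) (hT : 0 ≤ T) (j : ℕ) :
    ((translatesMeeting A T j).card : ℝ) ≤ 2 ^ j * (2 * T + 2 * A + 3) := by
  have hpow : (1 : ℝ) ≤ 2 ^ j := one_le_pow₀ one_le_two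
  have hceil : (⌈(2 : ℝ) ^ (j : ℤ) * T + A⌉₊ : ℝ) < 2 ^ (j : ℤ) * T + A + 1 :=
    Nat.ceil_lt_add_one (by positivity)
  have hcard : (translatesMeeting A T j).card = 2 * ⌈(2 : ℝ) ^ (j : ℤ) * T + A⌉₊ + 1 := by
    rw [translatesMeeting, Int.card_Icc]
    omega
  rw [hcard]
  push_cast
  rw [zpow_natCast] at hceil ⊢
  nlinarith

lemma eLpNorm_waveletCoeff_le (hA : 0 ≤ A) (hT : 0 ≤ T) (hg : ∀ x, A < |x| → g x = 0)
    (hf : ∀ x, T < |x| → f x = 0) (j : ℕ) {b : ℝ} (hb : ∀ k, |waveletCoeff g f j k| ≤ b)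
    (p : ℝ≥0∞) :
    eLpNorm (fun k : ℤ => waveletCoeff g f j k) p Measure.count ≤
      ENNReal.ofReal (b * (2 ^ j * (2 * T + 2 * A + 3)) ^ (1 / p).toReal) := by
  have hb0 : 0 ≤ b := (abs_nonneg _).trans (hb 0)
  have henorm : ∀ k, ‖waveletCoeff g f j k‖ₑ ≤ ENNReal.ofReal b := fun k => by
    rw [← ofReal_norm]
    exact ENNReal.ofReal_le_ofReal (hb k)
  refine (eLpNorm_count_le_of_finset (translatesMeeting A T j) p
    (fun k hk => waveletCoeff_eq_zero hg hf hk) henorm).trans ?_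
  rw [ENNReal.ofReal_mul hb0,
    ← ENNReal.ofReal_rpow_of_nonneg (by positivity) ENNReal.toReal_nonneg, ← ENNReal.ofReal_natCast]
  gcongr
  exact card_translatesMeeting_le hA hT j

lemma besovJ_const_mul_le (φ ψ : ℝ → ℝ) (s : ℝ) (p q : ℝ≥0∞) (c : ℝ) (f : ℝ → ℝ) :
    besovJ φ ψ s p q (fun x => c * f x) ≤ ‖c‖ₑ * besovJ φ ψ s p q f := by
  have hnorm (g : ℝ → ℝ) (j : ℤ) :
      eLpNorm (fun k : ℤ => waveletCoeff g (fun x => c * f x) j k) p Measure.count =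
        ‖c‖ₑ * eLpNorm (fun k : ℤ => waveletCoeff g f j k) p Measure.count := by
    simp only [waveletCoeff, mul_assoc, integral_const_mul]
    exact eLpNorm_const_smul c _ p _
  simp only [besovJ, hnorm, mul_add]
  gcongr
  refine eLpNorm_le_mul_eLpNorm_of_ae_le_mul' (c := ‖c‖₊) (.of_forall fun j => ?_) q
  simp only [enorm_eq_self]
  exact (mul_left_comm _ _ _).le

lemma integrable_mul_dyadic (hf : Integrable f) (hg : MemLp g ∞) (j k : ℤ) :
    Integrable fun x => f x * dyadic g j k x :=
  hf.mul_of_top_left (memLp_dyadic hg j k)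

lemma eLpNorm_waveletCoeff_add_le (hg : MemLp g ∞) (hf : Integrable f) (hf' : Integrable f')
    (j : ℤ) {p : ℝ≥0∞} (hp : 1 ≤ p) :
    eLpNorm (fun k : ℤ => waveletCoeff g (fun x => f x + f' x) j k) p Measure.count ≤
      eLpNorm (fun k : ℤ => waveletCoeff g f j k) p Measure.count +
        eLpNorm (fun k : ℤ => waveletCoeff g f' j k) p Measure.count := by
  have hadd : (fun k : ℤ => waveletCoeff g (fun x => f x + f' x) j k) =
      (fun k : ℤ => waveletCoeff g f j k) + fun k : ℤ => waveletCoeff g f' j k := by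
    funext k
    simp only [waveletCoeff, add_mul, Pi.add_apply]
    exact integral_add (integrable_mul_dyadic hf hg j k) (integrable_mul_dyadic hf' hg j k)
  rw [hadd]
  exact eLpNorm_add_le (measurable_of_countable _).aestronglyMeasurable
    (measurable_of_countable _).aestronglyMeasurable hp

lemma besovJ_add_le (hφ : MemLp φ ∞) (hψ : MemLp ψ ∞) (s : ℝ) {p q : ℝ≥0∞} (hp : 1 ≤ p)
    (hq : 1 ≤ q) (hf : Integrable f) (hf' : Integrable f') :
    besovJ φ ψ s p q (fun x => f x + f' x) ≤ besovJ φ ψ s p q f + besovJ φ ψ s p q f' := by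
  simp only [besovJ]
  rw [add_add_add_comm]
  refine add_le_add (eLpNorm_waveletCoeff_add_le hφ hf hf' 0 hp) (le_trans ?_
    (eLpNorm_add_le (measurable_of_countable _).aestronglyMeasurable
      (measurable_of_countable _).aestronglyMeasurable hq))
  refine eLpNorm_mono_enorm fun j => ?_
  simp only [enorm_eq_self, Pi.add_apply]
  rw [← mul_add]
  gcongr
  exact eLpNorm_waveletCoeff_add_le hψ hf hf' j hp

lemma besovJ_lt_top_of_abs_waveletCoeff_le (hA : 0 ≤ A) (hT : 0 ≤ T)
    (hφ : ∀ x, A < |x| → φ x = 0) (hψ : ∀ x, A < |x| → ψ x = 0) (hf : ∀ x, T < |x| → f x = 0)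
    {a b s σ : ℝ} (hα : ∀ k, |waveletCoeff φ f 0 k| ≤ a)
    (hβ : ∀ (j : ℕ) k, |waveletCoeff ψ f j k| ≤ b * 2 ^ (-(j * σ))) (hσ : s + 1 / 2 < σ)
    (p : ℝ≥0∞) {q : ℝ≥0∞} (hq : 1 ≤ q) : besovJ φ ψ s p q f < ∞ := by
  have hb : 0 ≤ b := by simpa using (abs_nonneg _).trans (hβ 0 0)
  refine ENNReal.add_lt_top.2
    ⟨(eLpNorm_waveletCoeff_le hA hT hφ hf 0 hα p).trans_lt ENNReal.ofReal_lt_top, ?_⟩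
  set W := 2 * T + 2 * A + 3
  have hW : 0 ≤ W := by positivity
  refine eLpNorm_count_lt_top_of_le_geometric hq (c := b * W ^ (1 / p).toReal)
    (ρ := 2 ^ (s + 1 / 2 - σ)) (by positivity) (by positivity)
    (Real.rpow_lt_one_of_one_lt_of_neg one_lt_two (by linarith)) fun j => ?_
  rw [two_rpow_eq_ofReal]
  refine (mul_le_mul_right (eLpNorm_waveletCoeff_le hA hT hψ hf j (hβ j) p) _).trans_eq ?_
  rw [← ENNReal.ofReal_mul (by positivity), Real.mul_rpow (by positivity) hW,
    ← Real.rpow_natCast 2 j, ← Real.rpow_natCast _ j, ← Real.rpow_mul two_pos.le,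
    ← Real.rpow_mul two_pos.le]
  have hexp : (2 : ℝ) ^ ((s + 1 / 2 - σ) * j) = 2 ^ (j * (s + 1 / 2 - (1 / p).toReal)) *
      2 ^ (-(j * σ)) * 2 ^ (j * (1 / p).toReal) := by
    rw [← Real.rpow_add two_pos, ← Real.rpow_add two_pos]
    ring_nf
  rw [hexp]
  ring_nf

namespace IsBoundedPair

variable {N : ℕ} {B s : ℝ} {p q : ℝ≥0∞}

lemma besovJ_lt_top (h : IsBoundedPair N A B φ ψ) (hs : s < N + 1) (p : ℝ≥0∞) (hq : 1 ≤ q)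
    (hf : ContDiff ℝ (⊤ : ℕ∞) f) (hT : 0 ≤ T) (hfT : ∀ x, T < |x| → f x = 0) :
    besovJ φ ψ s p q f < ∞ := by
  have hsupp : HasCompactSupport f :=
    .of_support_subset_isCompact isCompact_Icc (support_subset_Icc hfT)
  have hfi : Integrable f := hf.continuous.integrable_of_hasCompactSupport hsupp
  obtain ⟨D, hD⟩ : ∃ D, ∀ x, ‖iteratedDeriv (N + 1) f x‖ ≤ D := by
    have hcont := hf.continuous_iteratedDeriv (N + 1) (by exact_mod_cast le_top)
    exact hcont.bounded_above_of_compact_support (.of_support_subset_isCompact isCompact_Icc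
      (support_subset_Icc fun x hx => iteratedDeriv_eq_zero_of_lt_abs hfT _ hx))
  have hα : ∀ k, |waveletCoeff φ f 0 k| ≤ ∫ x, |f x| * B := fun k => by
    rw [← Real.norm_eq_abs]
    refine norm_integral_le_of_norm_le (hfi.abs.mul_const _) (.of_forall fun x => ?_)
    rw [norm_mul, dyadic_zero]
    exact mul_le_mul_of_nonneg_left (h.father.abs_le _) (norm_nonneg _)
  have hβ (j : ℕ) (k : ℤ) : |waveletCoeff ψ f j k| ≤
      D * (∫ y, |y| ^ (N + 1) * |ψ y|) * 2 ^ (-(j * (N + 1 + 1 / 2)) : ℝ) := by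
    refine (h.abs_waveletCoeff_mother_le hf hD j k).trans_eq ?_
    have hexp : (2 : ℝ) ^ (-(j * (N + 1 + 1 / 2)) : ℝ) =
        2 ^ (-(j : ℝ) / 2) * (2 ^ (-(j : ℤ))) ^ (N + 1) := by
      rw [← Real.rpow_intCast, ← Real.rpow_natCast, ← Real.rpow_mul two_pos.le,
        ← Real.rpow_add two_pos]
      push_cast
      ring_nf
    rw [hexp, Int.cast_natCast]
    ring
  exact besovJ_lt_top_of_abs_waveletCoeff_le h.radius_pos.le hT h.father.eq_zero
    h.mother.eq_zero hfT hα hβ (by linarith) p hq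

lemma besovJ_dyadic_mother_le (h : IsBoundedPair N A B φ ψ) (s : ℝ) (p q : ℝ≥0∞) (j : ℕ)
    (k : ℤ) :
    besovJ φ ψ s p q (dyadic ψ j k) ≤
      ENNReal.ofReal (2 ^ ((j : ℝ) * (s + 1 / 2 - (1 / p).toReal))) := by
  have hα (l : ℤ) : waveletCoeff φ (dyadic ψ j k) 0 l = 0 := by
    rw [← h.father_mother j l k]
    simp only [waveletCoeff, mul_comm]
  have hβ (i : ℕ) : (fun l : ℤ => waveletCoeff ψ (dyadic ψ j k) i l) =
      Pi.single k (if i = j then 1 else 0) := by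
    funext l
    rw [waveletCoeff, h.mother_mother, Pi.single_apply]
    simp only [Nat.cast_inj, eq_comm (a := i), eq_comm (a := l), ← ite_and, and_comm]
  rw [besovJ]
  simp only [hα, hβ, eLpNorm_zero', zero_add]
  rw [← two_rpow_eq_ofReal]
  refine (eLpNorm_mono_enorm fun i => ?_).trans (eLpNorm_count_single_le j
    ((2 : ℝ≥0∞) ^ ((j : ℝ) * (s + 1 / 2 - (1 / p).toReal))) q)
  simp only [enorm_eq_self]
  rcases eq_or_ne i j with rfl | hi
  · rw [Pi.single_eq_same, if_pos rfl]
    exact mul_le_of_le_one_right' ((eLpNorm_count_single_le k _ p).trans (by simp))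
  · simp [hi]

end IsBoundedPair

end BesovNorm

/-! ### Perturbed densities -/

/-- `f` is a probability density on the real line. -/
structure IsDensity (f : ℝ → ℝ) : Prop where
  nonneg : ∀ x, 0 ≤ f x
  integrable : Integrable f
  integral_eq_one : ∫ x, f x = 1

section Densities

variable {f g φ ψ : ℝ → ℝ} {s L T : ℝ} {p q : ℝ≥0∞}

lemma mem_densityClass_iff : f ∈ densityClass φ ψ s p q L T ↔
    IsDensity f ∧ (∀ x, T < |x| → f x = 0) ∧ besovJ φ ψ s p q f ≤ ENNReal.ofReal L := by
  have hsupp : Function.support f ⊆ Set.Icc (-T) T ↔ ∀ x, T < |x| → f x = 0 := by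
    simp only [Function.support_subset_iff', Set.mem_Icc, ← abs_le, not_le]
  rw [← hsupp]
  exact ⟨fun ⟨h0, hi, h1, hs, hJ⟩ => ⟨⟨h0, hi, h1⟩, hs, hJ⟩,
    fun ⟨⟨h0, hi, h1⟩, hs, hJ⟩ => ⟨h0, hi, h1, hs, hJ⟩⟩

lemma IsDensity.convex_combination (hf : IsDensity f) (hg : IsDensity g) {ε : ℝ} (hε : 0 ≤ ε)
    (hε1 : ε ≤ 1) : IsDensity fun x => (1 - ε) * f x + ε * g x where
  nonneg x := add_nonneg (mul_nonneg (sub_nonneg.2 hε1) (hf.nonneg x)) (mul_nonneg hε (hg.nonneg x))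
  integrable := (hf.integrable.const_mul _).add (hg.integrable.const_mul _)
  integral_eq_one := by
    rw [integral_add (hf.integrable.const_mul _) (hg.integrable.const_mul _), integral_const_mul,
      integral_const_mul, hf.integral_eq_one, hg.integral_eq_one]
    ring

lemma exists_smooth_density (hT : 0 < T) :
    ∃ g : ℝ → ℝ, IsDensity g ∧ ContDiff ℝ (⊤ : ℕ∞) g ∧ (∀ x, T < |x| → g x = 0) ∧
      ∃ c > 0, ∀ x, |x| ≤ T / 2 → c ≤ g x := by
  let b : ContDiffBump (0 : ℝ) := ⟨T / 2, T, half_pos hT, half_lt_self hT⟩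
  refine ⟨b.normed volume, ⟨b.nonneg_normed, b.integrable_normed, b.integral_normed⟩,
    b.contDiff_normed, fun x hx => ?_, 1 / ∫ x, b x, one_div_pos.2 b.integral_pos, fun x hx => ?_⟩
  · rw [← Function.notMem_support, b.support_normed_eq, Metric.mem_ball, dist_zero_right, not_lt]
    exact hx.le
  · rw [b.normed_def, b.one_of_mem_closedBall (by rwa [Metric.mem_closedBall, dist_zero_right])]

/-- `f` lies in the interior of the Besov ellipsoid, at distance at least `δ` from its boundary,
and is bounded below by `c` on `[-T/2, T/2]`: small multiples of wavelets supported there may be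
added to it. -/
structure IsInteriorDensity (φ ψ : ℝ → ℝ) (s : ℝ) (p q : ℝ≥0∞) (L T c δ : ℝ) (f : ℝ → ℝ) :
    Prop where
  isDensity : IsDensity f
  eq_zero : ∀ x, T < |x| → f x = 0
  le_apply : ∀ x, |x| ≤ T / 2 → c ≤ f x
  besovJ_add_le : besovJ φ ψ s p q f + ENNReal.ofReal δ ≤ ENNReal.ofReal L

lemma besovJ_convex_combination_le (hφ : MemLp φ ∞) (hψ : MemLp ψ ∞) (s : ℝ) (hp : 1 ≤ p)
    (hq : 1 ≤ q) (hf : Integrable f) (hg : Integrable g) {a d : ℝ} (ha : 0 ≤ a) (hd : 0 ≤ d)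
    (hJf : besovJ φ ψ s p q f ≤ ENNReal.ofReal a) (hJg : besovJ φ ψ s p q g ≤ ENNReal.ofReal d)
    {ε : ℝ} (hε : 0 ≤ ε) (hε1 : ε ≤ 1) :
    besovJ φ ψ s p q (fun x => (1 - ε) * f x + ε * g x) ≤
      ENNReal.ofReal ((1 - ε) * a + ε * d) := by
  have hε' : 0 ≤ 1 - ε := sub_nonneg.2 hε1
  calc _ ≤ ‖1 - ε‖ₑ * besovJ φ ψ s p q f + ‖ε‖ₑ * besovJ φ ψ s p q g :=
        (besovJ_add_le hφ hψ s hp hq (hf.const_mul _) (hg.const_mul _)).trans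
          (add_le_add (besovJ_const_mul_le _ _ _ _ _ _ _) (besovJ_const_mul_le _ _ _ _ _ _ _))
    _ ≤ ENNReal.ofReal (1 - ε) * ENNReal.ofReal a + ENNReal.ofReal ε * ENNReal.ofReal d := by
        rw [Real.enorm_of_nonneg hε', Real.enorm_of_nonneg hε]
        gcongr
    _ = ENNReal.ofReal ((1 - ε) * a + ε * d) := by
        rw [ENNReal.ofReal_add (by positivity) (by positivity), ENNReal.ofReal_mul hε',
          ENNReal.ofReal_mul hε]

lemma IsBoundedPair.exists_isInteriorDensity {N : ℕ} {A B : ℝ} (h : IsBoundedPair N A B φ ψ)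
    (hp : 1 ≤ p) (hq : 1 ≤ q) (hs : s < N + 1) (hT : 0 < T)
    (hne : ∃ f ∈ densityClass φ ψ s p q L T, besovJ φ ψ s p q f < ENNReal.ofReal L) :
    ∃ f, ∃ c > 0, ∃ δ > 0, IsInteriorDensity φ ψ s p q L T c δ f := by
  obtain ⟨f, hf, hJf⟩ := hne
  obtain ⟨hf, hfT, -⟩ := mem_densityClass_iff.1 hf
  obtain ⟨g, hg, hgs, hgT, c, hc, hcg⟩ := exists_smooth_density hT
  have hJg := h.besovJ_lt_top hs p hq hgs hT.le hgT
  set a := (besovJ φ ψ s p q f).toReal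
  set d := (besovJ φ ψ s p q g).toReal
  have haL : 0 < (L - a) / 2 := half_pos (sub_pos.2 (ENNReal.toReal_lt_of_lt_ofReal hJf))
  obtain ⟨ε', hε', hdε'⟩ := exists_pos_mul_lt haL d
  set ε := min 1 ε'
  have hε : 0 < ε := lt_min one_pos hε'
  have hε1 : ε ≤ 1 := min_le_left _ _
  have ha : 0 ≤ a := ENNReal.toReal_nonneg
  have hd : 0 ≤ d := ENNReal.toReal_nonneg
  have hεd : ε * d ≤ d * ε' := by
    rw [mul_comm]
    gcongr
    exact min_le_right _ _
  refine ⟨fun x => (1 - ε) * f x + ε * g x, ε * c, by positivity, (L - a) / 2, haL,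
    hf.convex_combination hg hε.le hε1, fun x hx => ?_, fun x hx => ?_, ?_⟩
  · rw [hfT x hx, hgT x hx, mul_zero, mul_zero, add_zero]
  · exact (mul_le_mul_of_nonneg_left (hcg x hx) hε.le).trans
      (le_add_of_nonneg_left (mul_nonneg (sub_nonneg.2 hε1) (hf.nonneg x)))
  · calc _ ≤ ENNReal.ofReal ((1 - ε) * a + ε * d) + ENNReal.ofReal ((L - a) / 2) := by
          gcongr
          exact besovJ_convex_combination_le h.father.memLp_top h.mother.memLp_top s hp hq
            hf.integrable hg.integrable ha hd (ENNReal.ofReal_toReal hJf.ne_top).ge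
            (ENNReal.ofReal_toReal hJg.ne).ge hε.le hε1
      _ ≤ ENNReal.ofReal L := by
          rw [← ENNReal.ofReal_add (by nlinarith) haL.le]
          exact ENNReal.ofReal_le_ofReal (by nlinarith)

end Densities

/-- The perturbation `f + γ g_{jk}` of `f` by a multiple of a dilated translate of `g`. -/
noncomputable def perturbation (g f : ℝ → ℝ) (γ : ℝ) (j k : ℤ) (x : ℝ) : ℝ :=
  f x + γ * dyadic g j k x

section Perturbations

variable {f g φ ψ : ℝ → ℝ} {A B T r γ : ℝ} {j k l : ℤ}

lemma dyadic_eq_zero (hg : ∀ x, A < |x| → g x = 0) (hk : |(k : ℝ)| + A ≤ 2 ^ j * T) {x : ℝ}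
    (hx : T < |x|) : dyadic g j k x = 0 := by
  have hdist := abs_sub_abs_le_abs_sub ((2 : ℝ) ^ j * x) k
  rw [abs_mul, abs_of_pos (by positivity : (0 : ℝ) < 2 ^ j)] at hdist
  have hscale : (2 : ℝ) ^ j * T < 2 ^ j * |x| := by gcongr
  rw [dyadic, hg _ (by linarith), mul_zero]

lemma integral_abs_perturbation_sub (g f : ℝ → ℝ) (hγ : 0 ≤ γ) (j k : ℤ) :
    ∫ x, |perturbation g f γ j k x - f x| = γ * 2 ^ (-(j : ℝ) / 2) * ∫ x, |g x| := by
  have hnorm := integral_abs_dyadic_rpow g j k 1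
  simp only [Real.rpow_one] at hnorm
  simp_rw [perturbation, add_sub_cancel_left, abs_mul, abs_of_nonneg hγ]
  rw [integral_const_mul, hnorm]
  ring_nf

lemma perturbation_eq_zero (hg : ∀ x, A < |x| → g x = 0) (hf : ∀ x, T < |x| → f x = 0)
    (hk : |(k : ℝ)| + A ≤ 2 ^ j * T) {x : ℝ} (hx : T < |x|) : perturbation g f γ j k x = 0 := by
  rw [perturbation, hf x hx, dyadic_eq_zero hg hk hx, mul_zero, add_zero]

lemma IsBddSupported.dyadic (hg : IsBddSupported A B g) (j k : ℤ) :
    IsBddSupported ((2 ^ j)⁻¹ * (|(k : ℝ)| + A)) (2 ^ ((j : ℝ) / 2) * B) (dyadic g j k) where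
  measurable := (hg.measurable.comp (by fun_prop)).const_mul _
  abs_le := abs_dyadic_le hg.abs_le j k
  eq_zero _ := dyadic_eq_zero hg.eq_zero (mul_inv_cancel_left₀ (by positivity) _).ge

lemma IsDensity.perturbation (hf : IsDensity f) (hg : IsBddSupported A B g)
    (hg0 : ∫ x, g x = 0) (hγ : 0 ≤ γ) {c : ℝ} (hγc : γ * (2 ^ ((j : ℝ) / 2) * B) ≤ c)
    (hfc : ∀ x, |x| ≤ T → c ≤ f x) (hk : |(k : ℝ)| + A ≤ 2 ^ j * T) :
    IsDensity (perturbation g f γ j k) where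
  nonneg x := by
    rw [LDPBesov.perturbation]
    rcases lt_or_ge T |x| with hx | hx
    · rw [dyadic_eq_zero hg.eq_zero hk hx, mul_zero, add_zero]
      exact hf.nonneg x
    · have hsmall : |γ * dyadic g j k x| ≤ c := by
        rw [abs_mul, abs_of_nonneg hγ]
        exact (mul_le_mul_of_nonneg_left (abs_dyadic_le hg.abs_le j k x) hγ).trans hγc
      linarith [(abs_le.1 hsmall).1, hfc x hx]
  integrable := hf.integrable.add ((hg.dyadic j k).integrable.const_mul γ)
  integral_eq_one := by
    have hmean : ∫ x, dyadic g j k x = 0 := by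
      simpa [hg0] using integral_mul_dyadic (fun _ => 1) g j k
    simp only [LDPBesov.perturbation]
    rw [integral_add hf.integrable ((hg.dyadic j k).integrable.const_mul γ), integral_const_mul,
      hmean, hf.integral_eq_one, mul_zero, add_zero]

lemma IsBoundedPair.perturbation_mem_densityClass {N : ℕ} {s L c δ : ℝ} {p q : ℝ≥0∞}
    (h : IsBoundedPair N A B φ ψ) (hp : 1 ≤ p) (hq : 1 ≤ q) (hT : 0 ≤ T)
    (hf : IsInteriorDensity φ ψ s p q L T c δ f) (hγ : 0 ≤ γ) {j : ℕ}
    (hγc : γ * (2 ^ ((j : ℝ) / 2) * B) ≤ c)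
    (hγδ : γ * 2 ^ ((j : ℝ) * (s + 1 / 2 - (1 / p).toReal)) ≤ δ)
    (hk : |(k : ℝ)| + A ≤ 2 ^ j * (T / 2)) :
    perturbation ψ f γ j k ∈ densityClass φ ψ s p q L T := by
  rw [← zpow_natCast] at hk
  refine mem_densityClass_iff.2 ⟨hf.isDensity.perturbation h.mother h.integral_mother_eq_zero hγ
    (by simpa using hγc) hf.le_apply hk, fun x hx => ?_, ?_⟩
  · refine perturbation_eq_zero h.mother.eq_zero hf.eq_zero (hk.trans ?_) hx
    gcongr
    exact half_le_self hT
  · refine le_trans ?_ hf.besovJ_add_le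
    refine (besovJ_add_le h.father.memLp_top h.mother.memLp_top s hp hq hf.isDensity.integrable
      ((h.mother.dyadic j k).integrable.const_mul γ)).trans ?_
    gcongr
    calc _ ≤ ‖γ‖ₑ * besovJ φ ψ s p q (dyadic ψ j k) := besovJ_const_mul_le _ _ _ _ _ _ _
      _ ≤ ENNReal.ofReal γ * ENNReal.ofReal (2 ^ ((j : ℝ) * (s + 1 / 2 - (1 / p).toReal))) := by
          rw [Real.enorm_of_nonneg hγ]
          gcongr
          exact h.besovJ_dyadic_mother_le s p q j k
      _ ≤ ENNReal.ofReal δ := by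
          rw [← ENNReal.ofReal_mul hγ]
          exact ENNReal.ofReal_le_ofReal hγδ

lemma dyadic_eq_zero_or_dyadic_eq_zero (hg : ∀ x, A < |x| → g x = 0)
    (hkl : 2 * A < |(k : ℝ) - l|) (x : ℝ) : dyadic g j k x = 0 ∨ dyadic g j l x = 0 := by
  have hdist := abs_sub_le (k : ℝ) (2 ^ j * x) l
  rw [abs_sub_comm (k : ℝ) (2 ^ j * x)] at hdist
  rcases lt_or_ge A |2 ^ j * x - (k : ℝ)| with hx | hx
  · exact .inl (by rw [dyadic, hg _ hx, mul_zero])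
  · exact .inr (by rw [dyadic, hg _ (by linarith), mul_zero])

lemma le_lintegral_abs_perturbation_sub_rpow (hg : IsBddSupported A B g) (hr : 0 < r)
    (f : ℝ → ℝ) (hγ : 0 ≤ γ) (hkl : 2 * A < |(k : ℝ) - l|) :
    ENNReal.ofReal (γ ^ r * (2 ^ ((j : ℝ) * (r / 2 - 1)) * ∫ x, |g x| ^ r)) ≤
      ∫⁻ x, ENNReal.ofReal (|perturbation g f γ j k x - perturbation g f γ j l x| ^ r) := by
  rw [← integral_abs_dyadic_rpow g j k r, ← integral_const_mul, ofReal_integral_eq_lintegral_ofReal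
    (((hg.dyadic j k).integrable_abs_rpow hr).const_mul _) (.of_forall fun x => by positivity)]
  refine lintegral_mono fun x => ENNReal.ofReal_le_ofReal ?_
  rw [← Real.mul_rpow hγ (abs_nonneg _), perturbation, perturbation, add_sub_add_left_eq_sub,
    ← mul_sub, abs_mul, abs_of_nonneg hγ]
  refine Real.rpow_le_rpow (by positivity) (mul_le_mul_of_nonneg_left ?_ hγ) hr.le
  rcases dyadic_eq_zero_or_dyadic_eq_zero (j := j) hg.eq_zero hkl x with hx | hx <;> simp [hx]

lemma IsBoundedPair.integral_abs_mother_rpow_pos {N : ℕ} (h : IsBoundedPair N A B φ ψ)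
    (hr : 0 < r) : 0 < ∫ x, |ψ x| ^ r := by
  rw [integral_pos_iff_support_of_nonneg (fun x => by positivity) (h.mother.integrable_abs_rpow hr),
    pos_iff_ne_zero]
  intro hsupp
  have hψ : ∀ᵐ x, ψ x = 0 := by
    filter_upwards [measure_eq_zero_iff_ae_notMem.1 hsupp] with x hx
    rwa [Function.notMem_support, Real.rpow_eq_zero (abs_nonneg _) hr.ne', abs_eq_zero] at hx
  have hnorm : ∫ x, dyadic ψ 0 0 x * dyadic ψ 0 0 x = 1 := by
    rw [h.mother_mother, if_pos ⟨rfl, rfl⟩]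
  rw [integral_eq_zero_of_ae (hψ.mono fun x hx => by simp [dyadic_zero, hx])] at hnorm
  exact zero_ne_one hnorm

end Perturbations

/-! ### Likelihood ratios -/

section LikelihoodRatio

variable {Ω : Type*} [MeasurableSpace Ω] {P ν : Measure Ω} {t : ℝ}

lemma sq_lintegral_mul_le {μ : Measure Ω} {f g : Ω → ℝ≥0∞} (hf : AEMeasurable f μ)
    (hg : AEMeasurable g μ) :
    (∫⁻ x, f x * g x ∂μ) ^ 2 ≤ (∫⁻ x, f x ^ 2 ∂μ) * ∫⁻ x, g x ^ 2 ∂μ := by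
  have hcs := ENNReal.lintegral_mul_le_Lp_mul_Lq μ Real.HolderConjugate.two_two hf hg
  simp only [Pi.mul_apply, ENNReal.rpow_two] at hcs
  refine (pow_le_pow_left₀ zero_le hcs 2).trans_eq ?_
  simp only [mul_pow, ← ENNReal.rpow_natCast, ← ENNReal.rpow_mul]
  norm_num

lemma absolutelyContinuous_of_abs_real_sub_le [IsFiniteMeasure P]
    (h : ∀ s, MeasurableSet s → |P.real s - ν.real s| ≤ t * ν.real s) : P ≪ ν := by
  refine .mk fun s hs hν => ?_
  have hνs : ν.real s = 0 := by simp [Measure.real, hν]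
  have hPs := h s hs
  rw [hνs, mul_zero, sub_zero, abs_nonpos_iff] at hPs
  rwa [measureReal_eq_zero_iff] at hPs

lemma ae_abs_toReal_rnDeriv_sub_one_le [IsFiniteMeasure P] [IsFiniteMeasure ν]
    (h : ∀ s, MeasurableSet s → |P.real s - ν.real s| ≤ t * ν.real s) :
    ∀ᵐ x ∂ν, |(P.rnDeriv ν x).toReal - 1| ≤ t := by
  have hac := absolutelyContinuous_of_abs_real_sub_le h
  have hρ : Integrable (fun x => (P.rnDeriv ν x).toReal) ν := Measure.integrable_toReal_rnDeriv
  have hupper : ∀ᵐ x ∂ν, (P.rnDeriv ν x).toReal ≤ 1 + t := by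
    refine ae_le_of_forall_setIntegral_le hρ (integrable_const _) fun s hs _ => ?_
    rw [Measure.setIntegral_toReal_rnDeriv hac, setIntegral_const, smul_eq_mul]
    linarith [(abs_le.1 (h s hs)).2]
  have hlower : ∀ᵐ x ∂ν, 1 - t ≤ (P.rnDeriv ν x).toReal := by
    refine ae_le_of_forall_setIntegral_le (integrable_const _) hρ fun s hs _ => ?_
    rw [Measure.setIntegral_toReal_rnDeriv hac, setIntegral_const, smul_eq_mul]
    linarith [(abs_le.1 (h s hs)).1]
  filter_upwards [hupper, hlower] with x hx₁ hx₂
  exact abs_le.2 ⟨by linarith, by linarith⟩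

lemma lintegral_rnDeriv_sq_le [IsProbabilityMeasure P] [IsProbabilityMeasure ν]
    (h : ∀ s, MeasurableSet s → |P.real s - ν.real s| ≤ t * ν.real s) :
    ∫⁻ x, P.rnDeriv ν x ^ 2 ∂ν ≤ ENNReal.ofReal (1 + t ^ 2) := by
  have hρ : Integrable (fun x => 2 * (P.rnDeriv ν x).toReal) ν :=
    Measure.integrable_toReal_rnDeriv.const_mul 2
  have hmean : ∫ x, (P.rnDeriv ν x).toReal ∂ν = 1 := by
    rw [Measure.integral_toReal_rnDeriv (absolutelyContinuous_of_abs_real_sub_le h), probReal_univ]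
  -- `ρ² = 2ρ - 1 + (ρ - 1)²`, and `ρ` has mean one.
  have hsq : ∀ᵐ x ∂ν, (P.rnDeriv ν x).toReal ^ 2 ≤ 2 * (P.rnDeriv ν x).toReal + (t ^ 2 - 1) := by
    filter_upwards [ae_abs_toReal_rnDeriv_sub_one_le h] with x hx
    nlinarith [sq_le_sq' (abs_le.1 hx).1 (abs_le.1 hx).2]
  calc ∫⁻ x, P.rnDeriv ν x ^ 2 ∂ν
      ≤ ∫⁻ x, ENNReal.ofReal (2 * (P.rnDeriv ν x).toReal + (t ^ 2 - 1)) ∂ν := by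
        refine lintegral_mono_ae ?_
        filter_upwards [hsq, P.rnDeriv_ne_top ν] with x hx hfin
        rw [← ENNReal.ofReal_toReal hfin, ← ENNReal.ofReal_pow ENNReal.toReal_nonneg]
        simpa only [ENNReal.toReal_ofReal ENNReal.toReal_nonneg] using ENNReal.ofReal_le_ofReal hx
    _ = ENNReal.ofReal (1 + t ^ 2) := by
        rw [← ofReal_integral_eq_lintegral_ofReal
          (f := fun x => 2 * (P.rnDeriv ν x).toReal + (t ^ 2 - 1)) (hρ.add (integrable_const _))
          (hsq.mono fun x hx => (sq_nonneg _).trans hx), integral_add hρ (integrable_const _),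
          integral_const_mul, hmean, integral_const, probReal_univ, one_smul]
        ring_nf

lemma sq_lintegral_le_of_abs_real_sub_le [IsProbabilityMeasure P] [IsProbabilityMeasure ν]
    (h : ∀ s, MeasurableSet s → |P.real s - ν.real s| ≤ t * ν.real s) {u : Ω → ℝ≥0∞}
    (hu : AEMeasurable u ν) :
    (∫⁻ x, u x ∂P) ^ 2 ≤ ENNReal.ofReal (1 + t ^ 2) * ∫⁻ x, u x ^ 2 ∂ν := by
  rw [← lintegral_rnDeriv_mul (absolutelyContinuous_of_abs_real_sub_le h) hu]
  refine (sq_lintegral_mul_le (P.measurable_rnDeriv ν).aemeasurable hu).trans ?_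
  gcongr
  exact lintegral_rnDeriv_sq_le h

end LikelihoodRatio

/-! ### Private samples -/

section Contraction

variable {Ω Z : Type*} [MeasurableSpace Ω] [MeasurableSpace Z] {μ : Measure Ω} {a f f₀ : Ω → ℝ}
  {c : ℝ}

lemma abs_sub_integral_mul_le (hc : 1 ≤ c) (hac : ∀ x y, a x ≤ c * a y)
    (hf₀ : ∀ x, 0 ≤ f₀ x) (hint : Integrable f₀ μ) (haf₀ : Integrable (fun x => a x * f₀ x) μ)
    (hf₀1 : ∫ x, f₀ x ∂μ = 1) (x : Ω) :
    |a x - ∫ y, a y * f₀ y ∂μ| ≤ (c - 1) * ∫ y, a y * f₀ y ∂μ := by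
  have hupper : a x ≤ c * ∫ y, a y * f₀ y ∂μ := calc
    a x = ∫ y, a x * f₀ y ∂μ := by rw [integral_const_mul, hf₀1, mul_one]
    _ ≤ ∫ y, c * (a y * f₀ y) ∂μ := integral_mono (hint.const_mul _) (haf₀.const_mul c) fun y => by
        simpa only [mul_assoc] using mul_le_mul_of_nonneg_right (hac x y) (hf₀ y)
    _ = c * ∫ y, a y * f₀ y ∂μ := integral_const_mul _ _
  have hlower : ∫ y, a y * f₀ y ∂μ ≤ c * a x := calc
    ∫ y, a y * f₀ y ∂μ ≤ ∫ y, c * a x * f₀ y ∂μ := integral_mono haf₀ (hint.const_mul _) fun y =>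
        mul_le_mul_of_nonneg_right (hac y x) (hf₀ y)
    _ = c * a x := by rw [integral_const_mul, hf₀1, mul_one]
  refine abs_le.2 ⟨?_, by linarith⟩
  nlinarith [mul_le_mul_of_nonneg_left hupper (sub_nonneg.2 hc)]

lemma abs_integral_mul_sub_integral_mul_le (hc : 1 ≤ c)
    (hac : ∀ x y, a x ≤ c * a y) (hf₀ : ∀ x, 0 ≤ f₀ x) (hfint : Integrable f μ)
    (hf₀int : Integrable f₀ μ) (haf : Integrable (fun x => a x * f x) μ)
    (haf₀ : Integrable (fun x => a x * f₀ x) μ) (hf1 : ∫ x, f x ∂μ = 1) (hf₀1 : ∫ x, f₀ x ∂μ = 1) :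
    |∫ x, a x * f x ∂μ - ∫ x, a x * f₀ x ∂μ| ≤
      (c - 1) * (∫ x, |f x - f₀ x| ∂μ) * ∫ x, a x * f₀ x ∂μ := by
  set b := ∫ x, a x * f₀ x ∂μ with hb
  have hsub : Integrable (fun x => f x - f₀ x) μ := hfint.sub hf₀int
  have hcenter : ∫ x, a x * f x ∂μ - b = ∫ x, (a x - b) * (f x - f₀ x) ∂μ := by
    have hzero : ∫ x, b * (f x - f₀ x) ∂μ = 0 := by
      rw [integral_const_mul, integral_sub hfint hf₀int, hf1, hf₀1, sub_self, mul_zero]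
    simp_rw [sub_mul]
    rw [integral_sub ((haf.sub haf₀).congr (.of_forall fun x => (mul_sub _ _ _).symm))
      (hsub.const_mul b), hzero, sub_zero, hb, ← integral_sub haf haf₀]
    simp_rw [mul_sub]
  calc |∫ x, a x * f x ∂μ - b|
      ≤ ∫ x, |(a x - b) * (f x - f₀ x)| ∂μ := hcenter ▸ abs_integral_le_integral_abs
    _ ≤ ∫ x, (c - 1) * b * |f x - f₀ x| ∂μ := by
        refine integral_mono_of_nonneg (.of_forall fun x => abs_nonneg _) (hsub.abs.const_mul _)
          (.of_forall fun x => ?_)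
        simp only [abs_mul]
        gcongr
        exact abs_sub_integral_mul_le hc hac hf₀ hf₀int haf₀ hf₀1 x
    _ = (c - 1) * (∫ x, |f x - f₀ x| ∂μ) * b := by rw [integral_const_mul]; ring

end Contraction

/-- The probability measure on the line with density `f`. -/
noncomputable abbrev densityMeasure (f : ℝ → ℝ) : Measure ℝ :=
  (volume : Measure ℝ).withDensity fun x => ENNReal.ofReal (f x)

section OneRelease

variable {Z : Type*} [MeasurableSpace Z] {f f₀ : ℝ → ℝ}

lemma IsDensity.isProbabilityMeasure (hf : IsDensity f) :
    IsProbabilityMeasure (densityMeasure f) := by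
  constructor
  rw [withDensity_apply _ MeasurableSet.univ, Measure.restrict_univ,
    ← ofReal_integral_eq_lintegral_ofReal hf.integrable (.of_forall hf.nonneg),
    hf.integral_eq_one, ENNReal.ofReal_one]

lemma integrable_kernel_real_mul (κ : Kernel ℝ Z) [IsMarkovKernel κ] (hf : Integrable f) {s : Set Z}
    (hs : MeasurableSet s) : Integrable fun x => (κ x).real s * f x :=
  hf.bdd_mul (c := 1) (κ.measurable_coe hs).ennreal_toReal.aestronglyMeasurable
    (.of_forall fun x => by
      rw [Real.norm_of_nonneg measureReal_nonneg]
      exact measureReal_le_one)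

lemma IsDensity.real_bind (hf : IsDensity f) (κ : Kernel ℝ Z) [IsMarkovKernel κ] {s : Set Z}
    (hs : MeasurableSet s) :
    ((densityMeasure f).bind κ).real s = ∫ x, (κ x).real s * f x := by
  rw [Measure.real, Measure.bind_apply hs κ.aemeasurable,
    lintegral_withDensity_eq_lintegral_mul₀ hf.integrable.aemeasurable.ennreal_ofReal
      (κ.measurable_coe hs).aemeasurable,
    integral_eq_lintegral_of_nonneg_ae
      (.of_forall fun x => mul_nonneg measureReal_nonneg (hf.nonneg x))
      (integrable_kernel_real_mul κ hf.integrable hs).aestronglyMeasurable]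
  congr 1
  refine lintegral_congr fun x => ?_
  rw [Pi.mul_apply, ENNReal.ofReal_mul measureReal_nonneg, ofReal_measureReal, mul_comm]

lemma IsDensity.abs_real_bind_sub_le (hf : IsDensity f) (hf₀ : IsDensity f₀) (κ : Kernel ℝ Z)
    [IsMarkovKernel κ] {α : ℝ} (hα : 0 ≤ α)
    (hκ : ∀ x x' s, MeasurableSet s → κ x s ≤ ENNReal.ofReal (Real.exp α) * κ x' s) {s : Set Z}
    (hs : MeasurableSet s) :
    |((densityMeasure f).bind κ).real s - ((densityMeasure f₀).bind κ).real s| ≤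
      (Real.exp α - 1) * (∫ x, |f x - f₀ x|) * ((densityMeasure f₀).bind κ).real s := by
  rw [hf.real_bind κ hs, hf₀.real_bind κ hs]
  refine abs_integral_mul_sub_integral_mul_le (Real.one_le_exp hα) (fun x y => ?_) hf₀.nonneg
    hf.integrable hf₀.integrable (integrable_kernel_real_mul κ hf.integrable hs)
    (integrable_kernel_real_mul κ hf₀.integrable hs) hf.integral_eq_one hf₀.integral_eq_one
  have hreal := ENNReal.toReal_mono (by finiteness) (hκ x y s hs)
  rwa [ENNReal.toReal_mul, ENNReal.toReal_ofReal (Real.exp_pos α).le] at hreal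

end OneRelease

section OneStep

variable {E Z : Type*} [MeasurableSpace E] [MeasurableSpace Z] {f : ℝ → ℝ}

/-- The conditional law of a release given the past `z : E`, when the private observation has
density `f` and is released through `κ`. -/
noncomputable def stepKernel (κ : Kernel (E × ℝ) Z) (f : ℝ → ℝ) : Kernel E Z :=
  κ ∘ₖ (Kernel.id ×ₖ Kernel.const E (densityMeasure f))

lemma IsDensity.stepKernel_apply (hf : IsDensity f) (κ : Kernel (E × ℝ) Z) (z : E) :
    stepKernel κ f z = (densityMeasure f).bind (κ.sectR z) := by
  have := hf.isProbabilityMeasure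
  ext s hs
  rw [stepKernel, Kernel.comp_apply, Kernel.prod_apply, Kernel.id_apply, Kernel.const_apply,
    Measure.dirac_prod, Measure.bind_apply hs κ.aemeasurable, Measure.bind_apply hs
    (κ.sectR z).aemeasurable, lintegral_map (κ.measurable_coe hs) measurable_prodMk_left]
  rfl

lemma IsDensity.lintegral_stepKernel (hf : IsDensity f) (κ : Kernel (E × ℝ) Z) (z : E)
    {u : Z → ℝ≥0∞} (hu : Measurable u) :
    ∫⁻ w, u w ∂(stepKernel κ f z) = ∫⁻ x, ∫⁻ w, u w ∂(κ (z, x)) ∂(densityMeasure f) := by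
  rw [hf.stepKernel_apply, Measure.lintegral_bind (κ.sectR z).aemeasurable hu.aemeasurable]
  simp only [Kernel.sectR_apply]

lemma IsDensity.isMarkovKernel_stepKernel (hf : IsDensity f) (κ : Kernel (E × ℝ) Z)
    [IsMarkovKernel κ] : IsMarkovKernel (stepKernel κ f) := by
  have := hf.isProbabilityMeasure
  rw [stepKernel]
  infer_instance

end OneStep

lemma lintegral_pi_succ {Ω : Type*} [MeasurableSpace Ω] (μ : Measure Ω) [SigmaFinite μ] {n : ℕ}
    {G : Ω × (Fin n → Ω) → ℝ≥0∞} (hG : Measurable G) :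
    ∫⁻ x, G (x (Fin.last n), fun i => x i.castSucc) ∂(Measure.pi fun _ : Fin (n + 1) => μ) =
      ∫⁻ v, ∫⁻ y, G (y, v) ∂μ ∂(Measure.pi fun _ : Fin n => μ) := by
  have hpi := (measurePreserving_piFinSuccAbove (fun _ => μ) (Fin.last n)).lintegral_comp hG
  have hcomp (x : Fin (n + 1) → Ω) :
      MeasurableEquiv.piFinSuccAbove (fun _ => Ω) (Fin.last n) x =
        (x (Fin.last n), fun i => x i.castSucc) := by
    ext i
    · rfl
    · simp [MeasurableEquiv.piFinSuccAbove, Fin.init]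
  simp only [hcomp] at hpi
  rw [hpi, lintegral_prod_symm' _ hG]

section Releases

variable {Z : Type*} [MeasurableSpace Z] {Q : (i : ℕ) → Kernel ((Fin i → Z) × ℝ) Z} {f f₀ : ℝ → ℝ}

lemma measurable_finSnoc (n : ℕ) :
    Measurable fun w : (Fin n → Z) × Z => (Fin.snoc w.1 w.2 : Fin (n + 1) → Z) := by
  refine measurable_pi_lambda _ fun i => ?_
  refine Fin.lastCases ?_ (fun i => ?_) i
  · simpa using measurable_snd
  · simp only [Fin.snoc_castSucc]
    fun_prop

lemma isMarkovKernel_release (hQ : ∀ i, IsMarkovKernel (Q i)) (n : ℕ) :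
    IsMarkovKernel (release Q n) := by
  induction n with
  | zero =>
    rw [release]
    infer_instance
  | succ n ih =>
    have := hQ n
    rw [release]
    exact Kernel.IsMarkovKernel.map _ (measurable_finSnoc n)

lemma lintegral_release_succ (hQ : ∀ i, IsMarkovKernel (Q i)) {n : ℕ} (x : Fin (n + 1) → ℝ)
    {u : (Fin (n + 1) → Z) → ℝ≥0∞} (hu : Measurable u) :
    ∫⁻ z, u z ∂(release Q (n + 1) x) =
      ∫⁻ z, ∫⁻ w, u (Fin.snoc z w) ∂(Q n (z, x (Fin.last n)))
        ∂(release Q n fun i => x i.castSucc) := by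
  have := hQ n
  have := isMarkovKernel_release hQ n
  rw [release, Kernel.lintegral_map _ (measurable_finSnoc n) _ hu,
    Kernel.lintegral_compProd _ _ _ (f := fun w => u (Fin.snoc w.1 w.2))
      (hu.comp (measurable_finSnoc n))]
  simp only [Kernel.comap_apply]

lemma isProbabilityMeasure_privateLaw (hQ : ∀ i, IsMarkovKernel (Q i)) (hf : IsDensity f) (n : ℕ) :
    IsProbabilityMeasure (privateLaw Q n f) := by
  have := hf.isProbabilityMeasure
  have := isMarkovKernel_release hQ n
  rw [privateLaw]
  infer_instance

lemma lintegral_privateLaw_zero (hf : IsDensity f) {u : (Fin 0 → Z) → ℝ≥0∞} (hu : Measurable u) :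
    ∫⁻ z, u z ∂(privateLaw Q 0 f) = u Fin.elim0 := by
  have := hf.isProbabilityMeasure
  rw [privateLaw, Measure.lintegral_bind (release Q 0).aemeasurable hu.aemeasurable]
  simp [release, lintegral_dirac' _ hu]

lemma lintegral_privateLaw_succ (hQ : ∀ i, IsMarkovKernel (Q i)) (hf : IsDensity f) {n : ℕ}
    {u : (Fin (n + 1) → Z) → ℝ≥0∞} (hu : Measurable u) :
    ∫⁻ z, u z ∂(privateLaw Q (n + 1) f) =
      ∫⁻ z, ∫⁻ w, u (Fin.snoc z w) ∂(stepKernel (Q n) f z) ∂(privateLaw Q n f) := by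
  have := hf.isProbabilityMeasure
  have := isMarkovKernel_release hQ n
  have := hQ n
  have := hf.isMarkovKernel_stepKernel (Q n)
  have hsnoc : Measurable fun w : (Fin n → Z) × Z => u (Fin.snoc w.1 w.2) :=
    hu.comp (measurable_finSnoc n)
  have hstep : Measurable fun zx : (Fin n → Z) × ℝ => ∫⁻ w, u (Fin.snoc zx.1 w) ∂(Q n zx) :=
    Measurable.lintegral_kernel_prod_right' (κ := Q n)
      (hsnoc.comp (by fun_prop : Measurable fun v : ((Fin n → Z) × ℝ) × Z => (v.1.1, v.2)))
  have hpast : Measurable fun yx : ℝ × (Fin n → ℝ) =>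
      ∫⁻ z, ∫⁻ w, u (Fin.snoc z w) ∂(Q n (z, yx.1)) ∂(release Q n yx.2) :=
    Measurable.lintegral_kernel_prod_right' (κ := (release Q n).comap Prod.snd measurable_snd)
      (f := fun v : (ℝ × (Fin n → ℝ)) × (Fin n → Z) =>
        ∫⁻ w, u (Fin.snoc v.2 w) ∂(Q n (v.2, v.1.1))) (hstep.comp (by fun_prop))
  rw [privateLaw, Measure.lintegral_bind (release Q (n + 1)).aemeasurable hu.aemeasurable]
  simp_rw [lintegral_release_succ hQ _ hu]
  rw [lintegral_pi_succ (densityMeasure f) hpast, privateLaw, Measure.lintegral_bind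
    (release Q n).aemeasurable hsnoc.lintegral_kernel_prod_right'.aemeasurable]
  have hkernel (z : Fin n → Z) : ∫⁻ w, u (Fin.snoc z w) ∂(stepKernel (Q n) f z) =
      ∫⁻ y, ∫⁻ w, u (Fin.snoc z w) ∂(Q n (z, y)) ∂(densityMeasure f) :=
    hf.lintegral_stepKernel (Q n) z (hsnoc.comp measurable_prodMk_left)
  refine lintegral_congr fun x => ?_
  simp_rw [hkernel]
  exact lintegral_lintegral_swap (f := fun y z => ∫⁻ w, u (Fin.snoc z w) ∂(Q n (z, y)))
    (hstep.comp measurable_swap).aemeasurable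

lemma PrivateMechanism.sq_lintegral_privateLaw_le {α : ℝ} (hα : 0 ≤ α) (M : PrivateMechanism α Z)
    (hf : IsDensity f) (hf₀ : IsDensity f₀) {n : ℕ} {u : (Fin n → Z) → ℝ≥0∞} (hu : Measurable u) :
    (∫⁻ z, u z ∂(privateLaw M.Q n f)) ^ 2 ≤
      ENNReal.ofReal (1 + ((Real.exp α - 1) * ∫ x, |f x - f₀ x|) ^ 2) ^ n *
        ∫⁻ z, u z ^ 2 ∂(privateLaw M.Q n f₀) := by
  induction n with
  | zero =>
    rw [lintegral_privateLaw_zero hf hu, lintegral_privateLaw_zero hf₀ (hu.pow_const 2), pow_zero,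
      one_mul]
  | succ n ih =>
    have := M.markov n
    have := hf.isMarkovKernel_stepKernel (M.Q n)
    have := hf₀.isMarkovKernel_stepKernel (M.Q n)
    have hsnoc : Measurable fun w : (Fin n → Z) × Z => u (Fin.snoc w.1 w.2) :=
      hu.comp (measurable_finSnoc n)
    rw [lintegral_privateLaw_succ M.markov hf hu,
      lintegral_privateLaw_succ M.markov hf₀ (hu.pow_const 2)]
    refine (ih hsnoc.lintegral_kernel_prod_right').trans ?_
    rw [pow_succ (ENNReal.ofReal _) n, mul_assoc]
    gcongr
    rw [← lintegral_const_mul _ (hsnoc.pow_const 2).lintegral_kernel_prod_right']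
    refine lintegral_mono fun z => sq_lintegral_le_of_abs_real_sub_le (fun s hs => ?_)
      (hsnoc.comp measurable_prodMk_left).aemeasurable
    rw [hf.stepKernel_apply, hf₀.stepKernel_apply]
    exact hf.abs_real_bind_sub_le hf₀ _ hα (M.isPrivate n z) hs

end Releases

/-! ### Reduction to testing -/

section Testing

variable {X : Type*} [MeasurableSpace X] {r : ℝ}

lemma ofReal_abs_sub_rpow_le (hr : 1 ≤ r) (a b c : ℝ) :
    ENNReal.ofReal (|a - b| ^ r) ≤
      2 ^ (r - 1) * (ENNReal.ofReal (|c - a| ^ r) + ENNReal.ofReal (|c - b| ^ r)) := by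
  have hr0 : 0 ≤ r := by linarith
  simp only [← ENNReal.ofReal_rpow_of_nonneg (abs_nonneg _) hr0]
  refine le_trans ?_ (ENNReal.rpow_add_le_mul_rpow_add_rpow _ _ hr)
  rw [← ENNReal.ofReal_add (abs_nonneg _) (abs_nonneg _), abs_sub_comm c a]
  exact ENNReal.rpow_le_rpow (ENNReal.ofReal_le_ofReal (abs_sub_le a c b)) hr0

lemma lintegral_abs_sub_rpow_le {μ : Measure X} (hr : 1 ≤ r) {f g h : X → ℝ}
    (hf : AEMeasurable f μ) (hh : AEMeasurable h μ) :
    ∫⁻ x, ENNReal.ofReal (|f x - g x| ^ r) ∂μ ≤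
      2 ^ (r - 1) * (∫⁻ x, ENNReal.ofReal (|h x - f x| ^ r) ∂μ +
        ∫⁻ x, ENNReal.ofReal (|h x - g x| ^ r) ∂μ) := by
  have hhf : AEMeasurable (fun x => ENNReal.ofReal (|h x - f x| ^ r)) μ :=
    ((hh.sub hf).abs.pow_const r).ennreal_ofReal
  rw [← lintegral_add_left' hhf, ← lintegral_const_mul' _ _ (by finiteness)]
  exact lintegral_mono fun x => ofReal_abs_sub_rpow_le hr _ _ _

lemma disjoint_setOf_lintegral_lt {ι : Type*} {μ : Measure X} (hr : 1 ≤ r) {f₁ f₂ : X → ℝ}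
    {g : ι → X → ℝ} {Δ : ℝ≥0∞} (hf₁ : AEMeasurable f₁ μ) (hg : ∀ z, AEMeasurable (g z) μ)
    (hsep : Δ ≤ ∫⁻ x, ENNReal.ofReal (|f₁ x - f₂ x| ^ r) ∂μ) :
    Disjoint {z | ∫⁻ x, ENNReal.ofReal (|g z x - f₁ x| ^ r) ∂μ < Δ * 2 ^ (-r)}
      {z | ∫⁻ x, ENNReal.ofReal (|g z x - f₂ x| ^ r) ∂μ < Δ * 2 ^ (-r)} := by
  refine Set.disjoint_left.2 fun z hz₁ hz₂ => hsep.not_gt ?_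
  calc ∫⁻ x, ENNReal.ofReal (|f₁ x - f₂ x| ^ r) ∂μ
      ≤ 2 ^ (r - 1) * (∫⁻ x, ENNReal.ofReal (|g z x - f₁ x| ^ r) ∂μ +
        ∫⁻ x, ENNReal.ofReal (|g z x - f₂ x| ^ r) ∂μ) := lintegral_abs_sub_rpow_le hr hf₁ (hg z)
    _ < 2 ^ (r - 1) * (Δ * 2 ^ (-r) + Δ * 2 ^ (-r)) :=
        ENNReal.mul_lt_mul_right (by simp [ENNReal.rpow_eq_zero_iff]) (by finiteness)
          (ENNReal.add_lt_add hz₁ hz₂)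
    _ = 2 ^ (r - 1) * 2 ^ (-r) * 2 ^ (1 : ℝ) * Δ := by rw [ENNReal.rpow_one]; ring
    _ = Δ := by
        rw [← ENNReal.rpow_add _ _ two_ne_zero ENNReal.ofNat_ne_top,
          ← ENNReal.rpow_add _ _ two_ne_zero ENNReal.ofNat_ne_top]
        ring_nf
        rw [ENNReal.rpow_zero, one_mul]

variable {Ω : Type*} [MeasurableSpace Ω]

lemma measurable_lintegral_abs_sub_rpow {μ : Measure X} [SFinite μ] {g : Ω → X → ℝ} {f : X → ℝ}
    (hg : Measurable (Function.uncurry g)) (hf : AEMeasurable f μ) (r : ℝ) :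
    Measurable fun z => ∫⁻ x, ENNReal.ofReal (|g z x - f x| ^ r) ∂μ := by
  have hmk (z : Ω) : ∫⁻ x, ENNReal.ofReal (|g z x - f x| ^ r) ∂μ =
      ∫⁻ x, ENNReal.ofReal (|g z x - hf.mk f x| ^ r) ∂μ :=
    lintegral_congr_ae (hf.ae_eq_mk.mono fun x hx => by simp only [hx])
  simp_rw [hmk]
  exact ((hg.sub (hf.measurable_mk.comp measurable_snd)).abs.pow_const
    r).ennreal_ofReal.lintegral_prod_right'

lemma exists_real_le_half {ι : Type*} [Fintype ι] [Nonempty ι] (P : ι → Measure Ω) (ν : Measure Ω)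
    [IsProbabilityMeasure ν] {K : ℝ} {E : ι → Set Ω} (hE : ∀ i, MeasurableSet (E i))
    (hdisj : Pairwise (Function.onFun Disjoint E)) (hK : 0 ≤ K) (hKι : 4 * K ≤ Fintype.card ι)
    (h : ∀ i, (P i).real (E i) ^ 2 ≤ K * ν.real (E i)) : ∃ i, (P i).real (E i) ≤ 1 / 2 := by
  by_contra! hlarge
  have htotal : ∑ i, ν.real (E i) ≤ 1 :=
    (sum_measureReal_le_measureReal_univ (fun i _ => hE i) fun i _ l _ hil => hdisj hil).trans_eq
      probReal_univ
  have hsum : ∑ _i : ι, (1 / 4 : ℝ) < ∑ i, K * ν.real (E i) :=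
    Finset.sum_lt_sum_of_nonempty Finset.univ_nonempty fun i _ =>
      lt_of_lt_of_le (by nlinarith [hlarge i]) (h i)
  rw [← Finset.mul_sum, Finset.sum_const, Finset.card_univ, nsmul_eq_mul] at hsum
  linarith [mul_le_mul_of_nonneg_left htotal hK]

lemma mul_inv_two_le_lintegral {P : Measure Ω} [IsProbabilityMeasure P] {d : Ω → ℝ≥0∞}
    (hd : Measurable d) {ε : ℝ≥0∞} (hP : P.real {z | d z < ε} ≤ 1 / 2) :
    ε * 2⁻¹ ≤ ∫⁻ z, d z ∂P := by
  refine le_trans ?_ (mul_meas_ge_le_lintegral hd ε)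
  gcongr
  have hcompl : {z | ε ≤ d z} = {z | d z < ε}ᶜ := by
    ext z
    simp
  rw [hcompl, ← ofReal_measureReal,
    probReal_compl_eq_one_sub (measurableSet_lt hd measurable_const), ← ENNReal.ofReal_ofNat,
    ← ENNReal.ofReal_inv_of_pos two_pos]
  exact ENNReal.ofReal_le_ofReal (by linarith)

end Testing

lemma PrivateMechanism.sq_real_privateLaw_le {Z : Type*} [MeasurableSpace Z] {α : ℝ} (hα : 0 ≤ α)
    (M : PrivateMechanism α Z) {f f₀ : ℝ → ℝ} (hf : IsDensity f) (hf₀ : IsDensity f₀) {n : ℕ}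
    {E : Set (Fin n → Z)} (hE : MeasurableSet E) :
    (privateLaw M.Q n f).real E ^ 2 ≤
      (1 + ((Real.exp α - 1) * ∫ x, |f x - f₀ x|) ^ 2) ^ n * (privateLaw M.Q n f₀).real E := by
  have := isProbabilityMeasure_privateLaw M.markov hf₀ n
  have hmoment := M.sq_lintegral_privateLaw_le hα hf hf₀ (measurable_one.indicator hE)
  have hsq : (fun z => E.indicator (1 : (Fin n → Z) → ℝ≥0∞) z ^ 2) = E.indicator 1 := by
    ext z
    by_cases hz : z ∈ E <;> simp [hz]
  rw [hsq, lintegral_indicator_one hE, lintegral_indicator_one hE] at hmoment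
  have hreal := ENNReal.toReal_mono (by finiteness) hmoment
  rwa [ENNReal.toReal_pow, ENNReal.toReal_mul, ENNReal.toReal_pow,
    ENNReal.toReal_ofReal (by positivity)] at hreal

lemma le_privateMinimaxRisk {ι : Type*} [Fintype ι] [Nonempty ι] {r α : ℝ} {Δ : ℝ≥0∞} {n : ℕ}
    {F : Set (ℝ → ℝ)} {f₀ : ℝ → ℝ} {f : ι → ℝ → ℝ} (hr : 1 ≤ r) (hα : 0 ≤ α) (hf₀ : IsDensity f₀)
    (hf : ∀ i, IsDensity (f i)) (hfF : ∀ i, f i ∈ F) {τ : ℝ} (hτ : ∀ i, ∫ x, |f i x - f₀ x| = τ)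
    (hsep : Pairwise fun i l => Δ ≤ ∫⁻ x, ENNReal.ofReal (|f i x - f l x| ^ r))
    (hcard : 4 * (1 + ((Real.exp α - 1) * τ) ^ 2) ^ n ≤ Fintype.card ι) :
    Δ * 2 ^ (-(r + 1)) ≤ privateMinimaxRisk.{u} r n α F := by
  refine le_iInf fun Z => le_iInf fun _ => le_iInf fun M => le_iInf fun g => ?_
  have hprob i := isProbabilityMeasure_privateLaw M.markov (hf i) n
  have := isProbabilityMeasure_privateLaw M.markov hf₀ n
  have hfm i := (hf i).integrable.aemeasurable
  have hloss i := measurable_lintegral_abs_sub_rpow (μ := volume) g.2 (hfm i) r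
  have hnear i := measurableSet_lt (hloss i) (measurable_const (a := Δ * 2 ^ (-r)))
  obtain ⟨i, hi⟩ := exists_real_le_half (fun i => privateLaw M.Q n (f i)) (privateLaw M.Q n f₀)
    hnear (fun i l hil => disjoint_setOf_lintegral_lt hr (hfm i)
      (fun z => (g.2.comp measurable_prodMk_left).aemeasurable) (hsep hil))
    (by positivity) hcard fun i => hτ i ▸ M.sq_real_privateLaw_le hα (hf i) hf₀ (hnear i)
  rw [neg_add, ENNReal.rpow_add _ _ two_ne_zero ENNReal.ofNat_ne_top, ENNReal.rpow_neg_one,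
    ← mul_assoc]
  exact (mul_inv_two_le_lintegral (hloss i) hi).trans (le_iSup₂_of_le (f i) (hfF i) le_rfl)

/-! ### Choice of the resolution level -/

lemma exists_nat_two_rpow_near {X D : ℝ} (hX : 1 ≤ X) (hD : 0 < D) :
    ∃ j : ℕ, X ≤ (2 : ℝ) ^ ((j : ℝ) * D) ∧ (2 : ℝ) ^ ((j : ℝ) * D) ≤ 2 ^ D * X := by
  obtain ⟨j, hj, hj'⟩ := exists_nat_pow_near hX (Real.one_lt_rpow one_lt_two hD)
  have hpow : (2 : ℝ) ^ (((j + 1 : ℕ) : ℝ) * D) = (2 ^ D) ^ (j + 1) := by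
    rw [mul_comm, Real.rpow_mul two_pos.le, Real.rpow_natCast]
  refine ⟨j + 1, hpow ▸ hj'.le, hpow ▸ ?_⟩
  rw [pow_succ']
  gcongr

lemma eventually_rpow_half_le_div_log :
    ∀ᶠ m : ℝ in Filter.atTop, m ^ (1 / 2 : ℝ) ≤ m / Real.log m := by
  filter_upwards [(isLittleO_log_rpow_atTop (r := 1 / 2) (by norm_num)).bound one_pos,
    Filter.eventually_gt_atTop 1] with m hlog hm
  have hm0 : 0 < m := by linarith
  rw [one_mul, Real.norm_of_nonneg (Real.log_nonneg hm.le),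
    Real.norm_of_nonneg (Real.rpow_nonneg hm0.le _)] at hlog
  rw [le_div_iff₀ (Real.log_pos hm)]
  calc m ^ (1 / 2 : ℝ) * Real.log m ≤ m ^ (1 / 2 : ℝ) * m ^ (1 / 2 : ℝ) := by gcongr
    _ = m := by rw [← Real.rpow_add hm0]; norm_num

/-- With `a` large against `c`, the level `2 ^ (j D) ≍ a m / log m` makes `m c 2 ^ (-j D)`, which
bounds the information in the sample, at most the logarithm of the number `2 ^ (j / 2)` of
perturbations. -/
lemma eventually_exists_level {D a c : ℝ} (hD : 0 < D) (ha : 1 ≤ a) (hac : 4 * D * c ≤ a) (G : ℝ) :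
    ∀ᶠ m : ℝ in Filter.atTop, 0 < m / Real.log m ∧ ∃ j : ℕ, G ≤ (2 : ℝ) ^ ((j : ℝ) / 2) ∧
      m * c * (2 : ℝ) ^ (-((j : ℝ) * D)) ≤ (j : ℝ) / 2 * Real.log 2 ∧
      (2 : ℝ) ^ ((j : ℝ) * D) ≤ 2 ^ D * (a * (m / Real.log m)) := by
  filter_upwards [eventually_rpow_half_le_div_log, Filter.eventually_gt_atTop 1,
    (tendsto_rpow_atTop (y := 1 / (4 * D)) (by positivity)).eventually_ge_atTop G]
    with m hhalf hm hmG
  have hm0 : 0 < m := by linarith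
  have hlog : 0 < Real.log m := Real.log_pos hm
  have hX : m ^ (1 / 2 : ℝ) ≤ a * (m / Real.log m) :=
    hhalf.trans (le_mul_of_one_le_left (by positivity) ha)
  obtain ⟨j, hj, hj'⟩ :=
    exists_nat_two_rpow_near ((Real.one_le_rpow hm.le (by norm_num)).trans hX) hD
  have hlogm : Real.log m / (4 * D) ≤ j / 2 * Real.log 2 := by
    have hmono := Real.log_le_log (by positivity) (hX.trans hj)
    rw [Real.log_rpow hm0, Real.log_rpow two_pos] at hmono
    rw [div_le_iff₀ (by positivity)]
    linarith
  refine ⟨by positivity, j, hmG.trans ?_, le_trans ?_ hlogm, hj'⟩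
  · rw [Real.rpow_def_of_pos hm0, Real.rpow_def_of_pos two_pos, Real.exp_le_exp]
    linarith [mul_one_div (Real.log m) (4 * D)]
  · rw [Real.rpow_neg two_pos.le, ← div_eq_mul_inv, div_le_div_iff₀ (by positivity) (by positivity)]
    calc m * c * (4 * D) = m * (4 * D * c) := by ring
      _ ≤ m * a := by gcongr
      _ = Real.log m * (a * (m / Real.log m)) := by field_simp
      _ ≤ Real.log m * 2 ^ ((j : ℝ) * D) := by gcongr

lemma rpow_neg_mul_rpow_neg_le {x y K e : ℝ} (hx : 0 < x) (hy : 0 ≤ y) (hK : 0 ≤ K) (he : 0 ≤ e)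
    (h : x ≤ K * y) : K ^ (-e) * y ^ (-e) ≤ x ^ (-e) := by
  rw [← Real.mul_rpow hK hy]
  exact Real.rpow_le_rpow_of_nonpos hx h (neg_nonpos.2 he)

lemma one_add_pow_le_two_rpow {x y : ℝ} {n : ℕ} (hx : 0 ≤ x) (h : n * x ≤ y * Real.log 2) :
    (1 + x) ^ n ≤ 2 ^ y := calc
  (1 + x) ^ n ≤ Real.exp x ^ n := by
    gcongr
    rw [add_comm]
    exact Real.add_one_le_exp x
  _ = Real.exp (n * x) := (Real.exp_nat_mul x n).symm
  _ ≤ Real.exp (y * Real.log 2) := Real.exp_le_exp.2 h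
  _ = 2 ^ y := by rw [Real.rpow_def_of_pos two_pos, mul_comm]

lemma exists_nat_four_mul_le {w S A T : ℝ} (hT : 0 < T) (hS : 0 ≤ S) (hA : 0 ≤ A)
    (hw : 1 + (10 * S + 2 * A) / T ≤ w) : ∃ m : ℕ, 4 * w ≤ m ∧ m * S + A ≤ w ^ 2 * (T / 2) := by
  have hw1 : 1 ≤ w := (le_add_of_nonneg_right (by positivity)).trans hw
  have hwT : 10 * S + 2 * A ≤ w * T := by
    rw [← div_le_iff₀ hT]
    linarith
  have hceil : (⌈4 * w⌉₊ : ℝ) ≤ 5 * w := by linarith [Nat.ceil_lt_add_one (by linarith : 0 ≤ 4 * w)]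
  refine ⟨⌈4 * w⌉₊, Nat.le_ceil _, ?_⟩
  calc (⌈4 * w⌉₊ : ℝ) * S + A ≤ 5 * w * S + w * A := by
        gcongr
        exact le_mul_of_one_le_left hA hw1
    _ = w * (10 * S + 2 * A) / 2 := by ring
    _ ≤ w * (w * T) / 2 := by gcongr
    _ = w ^ 2 * (T / 2) := by ring

/-! ### The lower bound -/

section LowerBound

variable {N : ℕ} {φ ψ f : ℝ → ℝ} {A B s r L T c δ α : ℝ} {p q : ℝ≥0∞}

lemma one_le_abs_sub_of_ne {m : ℕ} {i l : Fin m} (hil : i ≠ l) :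
    1 ≤ |((i : ℕ) : ℝ) - (l : ℕ)| := by
  have hne : ((i : ℕ) : ℤ) - (l : ℕ) ≠ 0 := by
    rw [sub_ne_zero]
    exact_mod_cast Fin.val_ne_of_ne hil
  exact_mod_cast Int.one_le_abs hne

lemma IsBoundedPair.le_privateMinimaxRisk_of_perturbation (h : IsBoundedPair N A B φ ψ)
    (hp : 1 ≤ p) (hq : 1 ≤ q) (hr : 1 ≤ r) (hT : 0 ≤ T) (hα : 0 ≤ α)
    (hf : IsInteriorDensity φ ψ s p q L T c δ f) {γ : ℝ} (hγ : 0 ≤ γ) {j n m S : ℕ}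
    (hγc : γ * (2 ^ ((j : ℝ) / 2) * B) ≤ c)
    (hγδ : γ * 2 ^ ((j : ℝ) * (s + 1 / 2 - (1 / p).toReal)) ≤ δ)
    (hS : 2 * A < S) (hmS : m * S + A ≤ 2 ^ j * (T / 2))
    (hcard : 4 * (1 + ((Real.exp α - 1) * (γ * 2 ^ (-(j : ℝ) / 2) * ∫ x, |ψ x|)) ^ 2) ^ n ≤ m) :
    ENNReal.ofReal (γ ^ r * (2 ^ ((j : ℝ) * (r / 2 - 1)) * ∫ x, |ψ x| ^ r)) * 2 ^ (-(r + 1)) ≤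
      privateMinimaxRisk.{u} r n α (densityClass φ ψ s p q L T) := by
  have hm : (0 : ℝ) < m := hcard.trans_lt' (by positivity)
  have : NeZero m := ⟨by exact_mod_cast hm.ne'⟩
  have hS0 : (0 : ℝ) < S := hS.trans_le' (by linarith [h.radius_pos])
  have hmem (i : Fin m) :
      perturbation ψ f γ j ((i : ℕ) * S : ℕ) ∈ densityClass φ ψ s p q L T := by
    refine h.perturbation_mem_densityClass hp hq hT hf hγ hγc hγδ (hmS.trans' ?_)
    have hi : ((i : ℕ) : ℝ) ≤ m := by exact_mod_cast i.2.le
    push_cast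
    rw [abs_of_nonneg (by positivity)]
    gcongr
  refine le_privateMinimaxRisk hr hα hf.isDensity (fun i => (mem_densityClass_iff.1 (hmem i)).1)
    hmem (fun i => integral_abs_perturbation_sub ψ f hγ j _) (fun i l hil => ?_)
    (by simpa using hcard)
  refine (le_lintegral_abs_perturbation_sub_rpow h.mother (by linarith) f hγ ?_).trans' (by simp)
  push_cast
  rw [← sub_mul, abs_mul, abs_of_pos hS0]
  exact hS.trans_le (le_mul_of_one_le_left hS0.le (one_le_abs_sub_of_ne hil))

lemma two_rpow_amplitude_mul_half (x σ : ℝ) :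
    (2 : ℝ) ^ (-(x * (σ + 1 / 2))) * 2 ^ (x / 2) = 2 ^ (-(x * σ)) := by
  rw [← Real.rpow_add two_pos]
  ring_nf

lemma sq_two_rpow_amplitude_mul_half (x σ : ℝ) :
    ((2 : ℝ) ^ (-(x * (σ + 1 / 2))) * 2 ^ (-x / 2)) ^ 2 = 2 ^ (-(x * (2 * σ + 2))) := by
  rw [← Real.rpow_add two_pos, ← Real.rpow_mul_natCast two_pos.le]
  ring_nf

lemma amplitude_rpow_mul (x σ r : ℝ) {c : ℝ} (hc : 0 ≤ c) :
    (c * (2 : ℝ) ^ (-(x * (σ + 1 / 2)))) ^ r * 2 ^ (x * (r / 2 - 1)) =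
      c ^ r * 2 ^ (-(x * (r * σ + 1))) := by
  rw [Real.mul_rpow hc (by positivity), ← Real.rpow_mul two_pos.le, mul_assoc,
    ← Real.rpow_add two_pos]
  ring_nf

lemma IsBoundedPair.le_privateMinimaxRisk_of_level (h : IsBoundedPair N A B φ ψ)
    (hp : 1 ≤ p) (hq : 1 ≤ q) (hr : 1 ≤ r) (hsp : (1 / p).toReal ≤ s) (hT : 0 < T) (hα : 0 ≤ α)
    (hf : IsInteriorDensity φ ψ s p q L T c δ f) {c₁ : ℝ} (hc₁ : 0 ≤ c₁) (hδ : c₁ ≤ δ)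
    (hc : c₁ * B ≤ c) {j n S : ℕ} (hS : 2 * A < S)
    (hj : 1 + (10 * S + 2 * A) / T ≤ (2 : ℝ) ^ ((j : ℝ) / 2))
    (hn : n * (Real.exp α - 1) ^ 2 * (c₁ * ∫ x, |ψ x|) ^ 2 *
      (2 : ℝ) ^ (-((j : ℝ) * (2 * (s - (1 / p).toReal) + 2))) ≤ (j : ℝ) / 2 * Real.log 2) :
    ENNReal.ofReal (c₁ ^ r * (∫ x, |ψ x| ^ r) * 2 ^ (-(r + 1)) *
      2 ^ (-((j : ℝ) * (r * (s - (1 / p).toReal) + 1)))) ≤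
        privateMinimaxRisk.{u} r n α (densityClass φ ψ s p q L T) := by
  set σ := s - (1 / p).toReal with hσ
  have hjσ : 0 ≤ (j : ℝ) * σ := mul_nonneg j.cast_nonneg (sub_nonneg.2 hsp)
  have hexp : s + 1 / 2 - (1 / p).toReal = σ + 1 / 2 := by rw [hσ]; ring
  set γ := c₁ * (2 : ℝ) ^ (-((j : ℝ) * (σ + 1 / 2))) with hγ
  obtain ⟨m, hm, hmS⟩ := exists_nat_four_mul_le hT S.cast_nonneg h.radius_pos.le hj
  have hγc : γ * (2 ^ ((j : ℝ) / 2) * B) ≤ c := by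
    refine hc.trans' ?_
    calc γ * (2 ^ ((j : ℝ) / 2) * B) = c₁ * B * 2 ^ (-((j : ℝ) * σ)) := by
          rw [← two_rpow_amplitude_mul_half, hγ]
          ring
      _ ≤ c₁ * B := mul_le_of_le_one_right (mul_nonneg hc₁ h.mother.bound_nonneg)
          (Real.rpow_le_one_of_one_le_of_nonpos one_le_two (neg_nonpos.2 hjσ))
  have hγδ : γ * 2 ^ ((j : ℝ) * (s + 1 / 2 - (1 / p).toReal)) ≤ δ := by
    rwa [hexp, hγ, mul_assoc, ← Real.rpow_add two_pos, neg_add_cancel, Real.rpow_zero, mul_one]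
  have hinfo : n * ((Real.exp α - 1) * (γ * 2 ^ (-(j : ℝ) / 2) * ∫ x, |ψ x|)) ^ 2 ≤
      (j : ℝ) / 2 * Real.log 2 := by
    refine hn.trans' (le_of_eq ?_)
    rw [← sq_two_rpow_amplitude_mul_half, hγ]
    ring
  have hcard : 4 * (1 + ((Real.exp α - 1) * (γ * 2 ^ (-(j : ℝ) / 2) * ∫ x, |ψ x|)) ^ 2) ^ n ≤ m :=
    hm.trans' (by gcongr; exact one_add_pow_le_two_rpow (sq_nonneg _) hinfo)
  have hmS' : m * S + A ≤ 2 ^ j * (T / 2) := by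
    rwa [← Int.cast_natCast j, two_rpow_half_sq, zpow_natCast] at hmS
  refine (h.le_privateMinimaxRisk_of_perturbation hp hq hr hT.le hα hf (by positivity) hγc hγδ hS
    hmS' hcard).trans' (le_of_eq ?_)
  rw [← mul_assoc (γ ^ r), hγ, amplitude_rpow_mul _ _ _ hc₁, ← ENNReal.ofReal_ofNat,
    ENNReal.ofReal_rpow_of_pos two_pos, ← ENNReal.ofReal_mul (by positivity)]
  ring_nf

lemma IsBoundedPair.exists_le_privateMinimaxRisk (h : IsBoundedPair N A B φ ψ)
    (hp : 1 ≤ p) (hq : 1 ≤ q) (hr : 1 ≤ r) (hsN : s < N + 1) (hsp : (1 / p).toReal ≤ s)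
    (hT : 0 < T)
    (hne : ∃ f ∈ densityClass φ ψ s p q L T, besovJ φ ψ s p q f < ENNReal.ofReal L) :
    ∃ C > 0, ∃ m₀ : ℝ, ∀ α : ℝ, 0 < α → ∀ n : ℕ, m₀ ≤ n * (Real.exp α - 1) ^ 2 →
      ENNReal.ofReal (C * (Real.log (n * (Real.exp α - 1) ^ 2) / (n * (Real.exp α - 1) ^ 2)) ^
          (r * (s - (1 / p).toReal + 1 / r) / (2 * (s - (1 / p).toReal) + 2))) ≤
        privateMinimaxRisk.{u} r n α (densityClass φ ψ s p q L T) := by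
  obtain ⟨f, c, hc, δ, hδ, hf⟩ := h.exists_isInteriorDensity hp hq hsN hT hne
  obtain ⟨S, hS⟩ := exists_nat_gt (2 * A)
  have hB := h.mother.bound_nonneg
  have hψr := h.integral_abs_mother_rpow_pos (r := r) (by linarith)
  set σ := s - (1 / p).toReal
  have hσ : 0 ≤ σ := sub_nonneg.2 hsp
  obtain ⟨c₁, hc₁, hc₁δ, hc₁B⟩ : ∃ c₁ > 0, c₁ ≤ δ ∧ c₁ * B ≤ c := by
    refine ⟨min δ (c / (B + 1)), lt_min hδ (by positivity), min_le_left _ _, ?_⟩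
    calc min δ (c / (B + 1)) * B ≤ c / (B + 1) * (B + 1) := by
          gcongr
          exacts [min_le_right _ _, by linarith]
      _ = c := div_mul_cancel₀ c (by positivity)
  set D := 2 * σ + 2
  set a := 1 + 4 * D * (c₁ * ∫ x, |ψ x|) ^ 2
  set e := (r * σ + 1) / D with he
  have hD : 0 < D := by positivity
  have ha : 1 ≤ a := le_add_of_nonneg_right (by positivity)
  obtain ⟨m₀, hm₀⟩ := Filter.eventually_atTop.1 (eventually_exists_level hD ha
    (le_add_of_nonneg_left zero_le_one) (1 + (10 * S + 2 * A) / T))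
  refine ⟨c₁ ^ r * (∫ x, |ψ x| ^ r) * 2 ^ (-(r + 1)) * (2 ^ D * a) ^ (-e), by positivity, m₀,
    fun α hα n hn => ?_⟩
  obtain ⟨hm, j, hj, hinfo, hlevel⟩ := hm₀ _ hn
  refine (h.le_privateMinimaxRisk_of_level hp hq hr hsp hT hα.le hf hc₁.le hc₁δ hc₁B hS hj
    hinfo).trans' (ENNReal.ofReal_le_ofReal ?_)
  have hexp : r * (σ + 1 / r) / D = e := by rw [he]; congr 1; field_simp
  have hrate : (2 : ℝ) ^ (-((j : ℝ) * (r * σ + 1))) = (2 ^ ((j : ℝ) * D)) ^ (-e) := by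
    rw [← Real.rpow_mul two_pos.le, he]
    congr 1
    field_simp
  rw [hexp, mul_assoc, hrate, ← inv_div, Real.inv_rpow hm.le, ← Real.rpow_neg hm.le]
  gcongr
  exact rpow_neg_mul_rpow_neg_le (by positivity) hm.le (by positivity) (by positivity)
    (by rwa [mul_assoc])

end LowerBound

end LDPBesov

theorem proposition2p2 (φ ψ : ℝ → ℝ) (N : ℕ) (hW : LDPBesov.IsWaveletPair N φ ψ)
    (s : ℝ) (p q : ℝ≥0∞) (r L T : ℝ)
    (hp : 1 ≤ p) (hq : 1 ≤ q) (hr : 1 ≤ r) (hs : 0 < s) (hsN : s < N + 1)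
    (hsp : (1 / p).toReal ≤ s) (hL : 0 < L) (hT : 0 < T)
    (hne : ∃ f ∈ LDPBesov.densityClass φ ψ s p q L T,
      LDPBesov.besovJ φ ψ s p q f < ENNReal.ofReal L) :
    ∃ C > 0, ∃ m₀ : ℝ, ∀ α : ℝ, 0 < α → ∀ n : ℕ, m₀ ≤ n * (Real.exp α - 1) ^ 2 →
      ENNReal.ofReal (C * (Real.log (n * (Real.exp α - 1) ^ 2) / (n * (Real.exp α - 1) ^ 2)) ^
          (r * (s - (1 / p).toReal + 1 / r) / (2 * (s - (1 / p).toReal) + 2))) ≤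
        LDPBesov.privateMinimaxRisk.{u} r n α (LDPBesov.densityClass φ ψ s p q L T) := by
  obtain ⟨A, B, φ', ψ', h, hφ, hψ⟩ := hW.exists_isBoundedPair
  rw [LDPBesov.densityClass_congr hφ hψ, LDPBesov.besovJ_congr hφ hψ] at hne
  rw [LDPBesov.densityClass_congr hφ hψ]
  exact h.exists_le_privateMinimaxRisk hp hq hr hsN hsp hT hne
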